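/- All hypergraphs are finite; their hyperedges form a multiset, and empty and singleton hyperedges are allowed. The \emph{generalized hypertree width} of a hypergraph $H$ is the minimum, over all tree decompositions of the primal graph of $H$ after removal of the vertices that lie in no hyperedge, of the maximum over all bags of the least number of hyperedges of $H$ whose union contains the bag. A \emph{$t$-boundaried hypergraph} is a hypergraph in which $t$ distinct vertices and hyperedges carry the labels $1,\dots,t$. Two of them are \emph{gluable} if no vertex of one has the label of a hyperedge of the other; then $H_1\oplus H_2$ is their disjoint union in which equally labeled vertices are identified and equally labeled hyperedges are replaced by their union. A \emph{$t$-boundaried graph} is a finite graph with vertices colored $1$ or $2$, of which $t$ distinct ones carry the labels $1,\dots,t$. The \emph{size-$t$ parsing operators} are: for $n_1+n_2=t$, the constant consisting of $t$ isolated boundary vertices, the first $n_1$ of color $1$ and the others of color $2$; adding an edge between the vertices labeled $1$ and $2$; for $\ell\in\{1,2\}$, adding a new vertex of color $\ell$ that takes over label $1$; the cyclic shift of the labels; exchanging the labels $1$ and $2$; and gluing two graphs whose equally labeled vertices have equal colors, by identifying equally labeled vertices of their disjoint union. A \emph{parse tree} is the expression tree of an expression over these operators. A graph $G$ is \emph{well-colored}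 if both its color classes are independent; it then represents the $t$-boundaried hypergraph $\mathcal H(G)$ whose vertices are the vertices of color $1$ and whose hyperedges are the neighborhoods $N(w)$ of the vertices $w$ of color $2$, with labels inherited. Let $\mathcal H_t^{\mathrm{small}}$ be the set of all $\mathcal H(G)$ with $G$ well-colored and generated by the size-$t$ parsing operators. For a class $\mathcal F$ of $t$-boundaried hypergraphs, the \emph{canonical right congruence} of $\mathcal F$ over $\mathcal H_t^{\mathrm{small}}$ is the equivalence relation on $\mathcal H_t^{\mathrm{small}}$ in which $H_1\sim_{\mathcal F}H_2$ iff $H_1$ and $H_2$ are gluable and, for every $K\in\mathcal H_t^{\mathrm{small}}$ gluable to both, $H_1\oplus K\in\mathcal F\iff H_2\oplus K\in\mathcal F$. Its \emph{index} is its number of classes. \textbf{Theorem.} Let $t\ge 41$ and let $\mathrm{GHTW}_4$ be the class of $t$-boundaried hypergraphs of generalized hypertree width at most $4$. (1) The canonical right congruence of $\mathrm{GHTW}_4$ over $\mathcal H_t^{\mathrm{small}}$ has infinite index. (2) There are pairwise gluable hypergraphs $H_0,H_1,H_2,\dots\in\mathcal H_t^{\mathrm{small}}$ such that, for all $n,m$,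 the hypergraph $H_n\oplus H_m$ has generalized hypertree width $4$ if and only if $n=m$. (3) There is no deterministic leaf-to-root tree automaton with finitely many states that, for every well-colored $G$ generated by the size-$t$ parsing operators and every parse tree of $G$, accepts that parse tree if and only if $\mathcal H(G)\in\mathrm{GHTW}_4$. -/

import Mathlib

namespace HTW

/-! ### Identifying equally labelled elements of two sets -/

section Gluing

variable {L A B : Type}

/-- `GlueRel la lb` relates `a : A` to `b : B` whenever they carry a common label, where `la i a`
(resp. `lb i b`) means that `a` (resp. `b`) has the label `i`. -/
inductive GlueRel (la : L → A → Prop) (lb : L → B → Prop) : A ⊕ B → A ⊕ B → Prop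
  | mk (i : L) (a : A) (b : B) : la i a → lb i b → GlueRel la lb (Sum.inl a) (Sum.inr b)

/-- The disjoint union of `A` and `B` with equally labelled elements identified. -/
abbrev Glued (la : L → A → Prop) (lb : L → B → Prop) : Type := Quot (GlueRel la lb)

/-- The image of an element of the left part. -/
def Glued.inl (la : L → A → Prop) (lb : L → B → Prop) (a : A) : Glued la lb :=
  Quot.mk _ (Sum.inl a)

/-- The image of an element of the right part. -/
def Glued.inr (la : L → A → Prop) (lb : L → B → Prop) (b : B) : Glued la lb :=
  Quot.mk _ (Sum.inr b)

theorem Glued.inl_injective {la : L → A → Prop} {lb : L → B → Prop}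
    (ha : ∀ i a a', la i a → la i a' → a = a')
    (hb : ∀ i j b, lb i b → lb j b → i = j) :
    Function.Injective (Glued.inl la lb) := by
  let f : A ⊕ B → Set A := Sum.elim (fun a => {a}) (fun b => {a | ∃ i, la i a ∧ lb i b})
  have hf : ∀ x y, GlueRel la lb x y → f x = f y := by
    rintro _ _ ⟨i, a, b, h1, h2⟩
    ext a'
    simp only [f, Sum.elim_inl, Sum.elim_inr, Set.mem_singleton_iff, Set.mem_ofPred_eq]
    constructor
    · rintro rfl
      exact ⟨i, h1, h2⟩
    · rintro ⟨j, h3, h4⟩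
      obtain rfl := hb i j b h2 h4
      exact ha _ _ _ h3 h1
  intro a a' h
  have h' : f (Sum.inl a) = f (Sum.inl a') := congrArg (Quot.lift f hf) h
  simpa [f] using h'

end Gluing

/-! ### Hypergraphs, tree decompositions, generalized hypertree width -/

/-- A finite hypergraph whose hyperedges form a multiset: hyperedges are indexed by `E`, and
`inc e` is the vertex set of the hyperedge `e`. Empty and singleton hyperedges are allowed. -/
structure MultiHypergraph where
  V : Type
  E : Type
  finV : Finite V
  finE : Finite E
  inc : E → Set V

/-- The primal (Gaifman) graph. -/
def MultiHypergraph.primalGraph (H : MultiHypergraph) : SimpleGraph H.V where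
  Adj u v := u ≠ v ∧ ∃ e, u ∈ H.inc e ∧ v ∈ H.inc e
  symm := ⟨fun _ _ h => ⟨h.1.symm, h.2.imp fun _ he => ⟨he.2, he.1⟩⟩⟩
  loopless := ⟨fun _ h => h.1 rfl⟩

/-- Remove the isolated vertices, that is, those that lie in no hyperedge. -/
def MultiHypergraph.removeIsolated (H : MultiHypergraph) : MultiHypergraph where
  V := {v : H.V // ∃ e, v ∈ H.inc e}
  E := H.E
  finV := by
    have := H.finV
    infer_instance
  finE := H.finE
  inc e := {v | v.1 ∈ H.inc e}

/-- A tree decomposition of a graph. -/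
structure TreeDecomposition {V : Type} (G : SimpleGraph V) where
  Node : Type
  finNode : Finite Node
  tree : SimpleGraph Node
  isTree : tree.IsTree
  bag : Node → Set V
  vertex_mem : ∀ v, ∃ x, v ∈ bag x
  edge_mem : ∀ u v, G.Adj u v → ∃ x, u ∈ bag x ∧ v ∈ bag x
  subtree : ∀ v, (tree.induce {x | v ∈ bag x}).Connected

/-- `X` has a cover consisting of at most `k` hyperedges. -/
def MultiHypergraph.CoverableBy (H : MultiHypergraph) (X : Set H.V) (k : ℕ) : Prop :=
  ∃ C : Finset H.E, C.card ≤ k ∧ ∀ v ∈ X, ∃ e ∈ C, v ∈ H.inc e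

/-- Some tree decomposition of the primal graph has cover width at most `k`. -/
def MultiHypergraph.HasCoverDecomposition (H : MultiHypergraph) (k : ℕ) : Prop :=
  ∃ D : TreeDecomposition H.primalGraph, ∀ x, H.CoverableBy (D.bag x) k

/-- The generalized hypertree width: the minimum cover width of a tree decomposition of the
primal graph, isolated vertices being removed first. -/
noncomputable def MultiHypergraph.ghtw (H : MultiHypergraph) : ℕ :=
  sInf {k | H.removeIsolated.HasCoverDecomposition k}

/-! ### Boundaried hypergraphs -/

/-- A `t`-boundaried hypergraph: `t` distinct vertices and hyperedges carry the labels
`1, …, t` (here the elements of `Fin t`). -/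
structure BdHypergraph (t : ℕ) extends MultiHypergraph where
  lab : Fin t ↪ V ⊕ E

namespace BdHypergraph

variable {t : ℕ}

/-- The vertex `v` has label `i`. -/
def VLab (H : BdHypergraph t) (i : Fin t) (v : H.V) : Prop := H.lab i = Sum.inl v

/-- The hyperedge `e` has label `i`. -/
def ELab (H : BdHypergraph t) (i : Fin t) (e : H.E) : Prop := H.lab i = Sum.inr e

/-- No vertex of one hypergraph has the label of a hyperedge of the other. -/
def Gluable (H₁ H₂ : BdHypergraph t) : Prop :=
  ∀ i, (∀ v e, ¬(H₁.VLab i v ∧ H₂.ELab i e)) ∧ (∀ e v, ¬(H₁.ELab i e ∧ H₂.VLab i v))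

theorem gluable_iff (H₁ H₂ : BdHypergraph t) :
    Gluable H₁ H₂ ↔ ∀ i, (H₁.lab i).isLeft = (H₂.lab i).isLeft := by
  refine forall_congr' fun i => ?_
  unfold VLab ELab
  rcases H₁.lab i with a | a <;> rcases H₂.lab i with b | b <;> simp

/-- The vertices of the glued hypergraph. -/
abbrev GlueV (H₁ H₂ : BdHypergraph t) : Type := Glued H₁.VLab H₂.VLab

/-- The hyperedges of the glued hypergraph. -/
abbrev GlueE (H₁ H₂ : BdHypergraph t) : Type := Glued H₁.ELab H₂.ELab

/-- The gluing of two gluable `t`-boundaried hypergraphs: the disjoint union, in which equally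
labelled vertices are identified and equally labelled hyperedges are replaced by their union. -/
def glue (H₁ H₂ : BdHypergraph t) (_h : Gluable H₁ H₂) : BdHypergraph t where
  V := GlueV H₁ H₂
  E := GlueE H₁ H₂
  finV := by
    have := H₁.finV
    have := H₂.finV
    infer_instance
  finE := by
    have := H₁.finE
    have := H₂.finE
    infer_instance
  inc q := {x |
    (∃ e v, q = Glued.inl _ _ e ∧ v ∈ H₁.inc e ∧ x = Glued.inl _ _ v) ∨
    (∃ e v, q = Glued.inr _ _ e ∧ v ∈ H₂.inc e ∧ x = Glued.inr _ _ v)}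
  lab :=
    { toFun := fun i => Sum.map (Glued.inl _ _) (Glued.inl _ _) (H₁.lab i)
      inj' := by
        refine (Function.Injective.sumMap ?_ ?_).comp H₁.lab.injective
        · refine Glued.inl_injective (fun i a a' h h' => ?_) (fun i j b h h' => ?_)
          · exact Sum.inl_injective (h.symm.trans h')
          · exact H₂.lab.injective (h.trans h'.symm)
        · refine Glued.inl_injective (fun i a a' h h' => ?_) (fun i j b h h' => ?_)
          · exact Sum.inr_injective (h.symm.trans h')
          · exact H₂.lab.injective (h.trans h'.symm) }

/-- The canonical right congruence of the hypergraph problem `F` over the universe `𝒰`: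
both the compared hypergraphs and the hypergraphs glued to them range over `𝒰`. -/
def canonicalCongruence (𝒰 F : Set (BdHypergraph t)) : Setoid 𝒰 where
  r H₁ H₂ := Gluable H₁.1 H₂.1 ∧
    ∀ K ∈ 𝒰, ∀ (h₁ : Gluable H₁.1 K) (h₂ : Gluable H₂.1 K),
      (H₁.1.glue K h₁ ∈ F ↔ H₂.1.glue K h₂ ∈ F)
  iseqv :=
    { refl := fun _ => ⟨(gluable_iff _ _).2 fun _ => rfl, fun _ _ _ _ => Iff.rfl⟩
      symm := fun h =>
        ⟨(gluable_iff _ _).2 fun i => ((gluable_iff _ _).1 h.1 i).symm,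
          fun K hK h₁ h₂ => (h.2 K hK h₂ h₁).symm⟩
      trans := fun {_ y _} h h' =>
        ⟨(gluable_iff _ _).2 fun i =>
            ((gluable_iff _ _).1 h.1 i).trans ((gluable_iff _ _).1 h'.1 i),
          fun K hK h₁ h₂ =>
            have hy : Gluable y.1 K := (gluable_iff _ _).2 fun i =>
              ((gluable_iff _ _).1 h.1 i).symm.trans ((gluable_iff _ _).1 h₁ i)
            (h.2 K hK h₁ hy).trans (h'.2 K hK hy h₂)⟩ }

end BdHypergraph

/-- The `t`-boundaried hypergraphs of generalized hypertree width at most `k`. -/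
def GHTW (t k : ℕ) : Set (BdHypergraph t) := {H | H.toMultiHypergraph.ghtw ≤ k}

/-! ### Boundaried two-colored graphs and the parsing operators -/

/-- A `t`-boundaried graph, colored with two colors. The colors 1 and 2 are the elements
`0` and `1` of `Fin 2`, and the labels `1, …, t` are the elements `0, …, t - 1` of `Fin t`. -/
structure BdGraph (t : ℕ) where
  V : Type
  finV : Finite V
  graph : SimpleGraph V
  color : V → Fin 2
  lab : Fin t ↪ V

namespace BdGraph

variable {t : ℕ}

/-- Isolated boundary vertices `1, …, t`; the first `n₁` have color 1, the others color 2. -/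
def isolated (t n₁ : ℕ) : BdGraph t where
  V := Fin t
  finV := inferInstance
  graph := ⊥
  color i := if i.val < n₁ then 0 else 1
  lab := Function.Embedding.refl _

/-- Add an edge between the boundary vertices labelled 1 and 2. -/
def addEdge (G : BdGraph t) : BdGraph t where
  V := G.V
  finV := G.finV
  graph := G.graph ⊔ SimpleGraph.fromRel fun u v =>
    ∃ i j : Fin t, i.val = 0 ∧ j.val = 1 ∧ u = G.lab i ∧ v = G.lab j
  color := G.color
  lab := G.lab

/-- Add a new boundary vertex of color `ℓ` and label it 1, unlabelling the vertex that was
labelled 1. -/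
def newVertex (ℓ : Fin 2) (G : BdGraph t) : BdGraph t where
  V := Option G.V
  finV := by
    have := G.finV
    infer_instance
  graph := SimpleGraph.fromRel fun u v => ∃ a b, G.graph.Adj a b ∧ u = some a ∧ v = some b
  color v := v.elim ℓ G.color
  lab :=
    { toFun := fun i => if i.val = 0 then none else some (G.lab i)
      inj' := by
        intro i j h
        by_cases hi : i.val = 0 <;> by_cases hj : j.val = 0
        · exact Fin.ext (hi.trans hj.symm)
        · simp [hi, hj] at h
        · simp [hi, hj] at h
        · simpa [hi, hj] using h }

/-- Relabel the boundary: the vertex with the new label `i` is the one with old label `σ i`. -/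
def relabel (σ : Equiv.Perm (Fin t)) (G : BdGraph t) : BdGraph t where
  V := G.V
  finV := G.finV
  graph := G.graph
  color := G.color
  lab := σ.toEmbedding.trans G.lab

/-- The cyclic shift: label `j` moves to the vertex that had the label `j + 1` modulo `t`. -/
def shift (G : BdGraph t) : BdGraph t := G.relabel (finRotate t)

/-- Exchange the labels 1 and 2. -/
def swap (G : BdGraph t) : BdGraph t :=
  G.relabel (if h : 2 ≤ t then Equiv.swap ⟨0, by omega⟩ ⟨1, by omega⟩ else Equiv.refl _)

/-- Vertices with the same label have the same color. -/
def ColorCompatible (G₁ G₂ : BdGraph t) : Prop :=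
  ∀ i, G₁.color (G₁.lab i) = G₂.color (G₂.lab i)

/-- The vertex `v` has label `i`. -/
def VLab (G : BdGraph t) (i : Fin t) (v : G.V) : Prop := G.lab i = v

/-- The gluing of two color-compatible graphs: the disjoint union with equally labelled
vertices identified. -/
def glue (G₁ G₂ : BdGraph t) (h : ColorCompatible G₁ G₂) : BdGraph t where
  V := Glued G₁.VLab G₂.VLab
  finV := by
    have := G₁.finV
    have := G₂.finV
    infer_instance
  graph := SimpleGraph.fromRel fun x y =>
    (∃ u v, G₁.graph.Adj u v ∧ x = Glued.inl _ _ u ∧ y = Glued.inl _ _ v) ∨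
    (∃ u v, G₂.graph.Adj u v ∧ x = Glued.inr _ _ u ∧ y = Glued.inr _ _ v)
  color := Quot.lift (Sum.elim G₁.color G₂.color) (by
    rintro _ _ ⟨i, a, b, ha, hb⟩
    unfold VLab at ha hb
    subst ha hb
    exact h i)
  lab :=
    { toFun := fun i => Glued.inl _ _ (G₁.lab i)
      inj' := by
        have h₁ : Function.Injective (Glued.inl G₁.VLab G₂.VLab) :=
          Glued.inl_injective (fun _ _ _ h h' => Eq.trans (Eq.symm h) h')
            (fun _ _ _ h h' => G₂.lab.injective (Eq.trans h (Eq.symm h')))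
        exact fun i j hij => G₁.lab.injective (h₁ hij) }

/-- Each of the two color classes is an independent set. -/
def WellColored (G : BdGraph t) : Prop := ∀ u v, G.graph.Adj u v → G.color u ≠ G.color v

/-- The boundaried hypergraph that a well-colored graph represents: its vertices are the
vertices of color 1, and every vertex `w` of color 2 gives a hyperedge, the neighborhood of `w`;
labels are inherited. -/
def hyperg (G : BdGraph t) : BdHypergraph t where
  V := {v : G.V // G.color v = 0}
  E := {w : G.V // G.color w = 1}
  finV := by
    have := G.finV
    infer_instance
  finE := by
    have := G.finV
    infer_instance
  inc w := {v | G.graph.Adj w.1 v.1}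
  lab :=
    { toFun := fun i =>
        if h : G.color (G.lab i) = 0 then Sum.inl ⟨G.lab i, h⟩
        else Sum.inr ⟨G.lab i, by omega⟩
      inj' := by
        intro i j hij
        apply G.lab.injective
        by_cases hi : G.color (G.lab i) = 0 <;> by_cases hj : G.color (G.lab j) = 0 <;>
          simp only [hi, hj, dite_true, dite_false, Sum.inl.injEq, Sum.inr.injEq,
            Subtype.mk.injEq, reduceCtorEq] at hij <;> exact hij }

end BdGraph

/-! ### Parse trees, the small universe, tree automata -/

/-- Nonempty finite rooted (ordered) trees in which every node has at most two children and
is labelled by a letter from `A`. -/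
inductive BinTree (A : Type) : Type
  | leaf (a : A) : BinTree A
  | node₁ (a : A) (x : BinTree A) : BinTree A
  | node₂ (a : A) (x y : BinTree A) : BinTree A

/-- The names of the size-`t` parsing operators for two colors. -/
inductive Op (t : ℕ) : Type
  | empty (n₁ n₂ : ℕ) (h : n₁ + n₂ = t) : Op t
  | edge : Op t
  | newVertex (ℓ : Fin 2) : Op t
  | shift : Op t
  | swap : Op t
  | glue : Op t

/-- `Parses p G`: the tree `p` is the parse tree of an expression over the size-`t` parsing
operators, and the value of that expression is `G`. -/
inductive Parses {t : ℕ} : BinTree (Op t) → BdGraph t → Prop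
  | empty (n₁ n₂ : ℕ) (h : n₁ + n₂ = t) :
      Parses (.leaf (.empty n₁ n₂ h)) (BdGraph.isolated t n₁)
  | edge {p : BinTree (Op t)} {G : BdGraph t} :
      Parses p G → Parses (.node₁ .edge p) G.addEdge
  | newVertex (ℓ : Fin 2) {p : BinTree (Op t)} {G : BdGraph t} :
      Parses p G → Parses (.node₁ (.newVertex ℓ) p) (G.newVertex ℓ)
  | shift {p : BinTree (Op t)} {G : BdGraph t} :
      Parses p G → Parses (.node₁ .shift p) G.shift
  | swap {p : BinTree (Op t)} {G : BdGraph t} :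
      Parses p G → Parses (.node₁ .swap p) G.swap
  | glue {p q : BinTree (Op t)} {G₁ G₂ : BdGraph t} (h : BdGraph.ColorCompatible G₁ G₂) :
      Parses p G₁ → Parses q G₂ → Parses (.node₂ .glue p q) (G₁.glue G₂ h)

/-- The small universe of `t`-boundaried hypergraphs: those represented by the well-colored
graphs that the size-`t` parsing operators generate. -/
def smallUniverse (t : ℕ) : Set (BdHypergraph t) :=
  {H | ∃ (p : BinTree (Op t)) (G : BdGraph t), Parses p G ∧ G.WellColored ∧ G.hyperg = H}

/-- A deterministic leaf-to-root finite-state tree automaton over the alphabet `A`. -/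
structure TreeAutomaton (A : Type) where
  Q : Type
  finQ : Finite Q
  start : Q
  δ₁ : A → Q → Q
  δ₂ : A → Q → Q → Q
  final : Set Q

/-- The state that the automaton reaches at the root. -/
def TreeAutomaton.run {A : Type} (M : TreeAutomaton A) : BinTree A → M.Q
  | .leaf a => M.δ₁ a M.start
  | .node₁ a x => M.δ₁ a (M.run x)
  | .node₂ a x y => M.δ₂ a (M.run x) (M.run y)

/-- The automaton accepts a tree if its state at the root is final. -/
def TreeAutomaton.Accepts {A : Type} (M : TreeAutomaton A) (x : BinTree A) : Prop :=
  M.run x ∈ M.final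

end HTW

/-!
The three claims follow from one family of boundaried hypergraphs, the *gadgets*, such that two glued
gadgets have generalized hypertree width 4 if their chains are equally long and more than 4 otherwise:
distinct gadgets are then inequivalent, and an automaton that reaches the same state on the parse
trees of two of them cannot tell both gluings with one of the two apart.

A gadget has 15 labelled *constants*, namely four blocks of three vertices and three markers, and a
chain `c 0, …, c (n + 1)` of private vertices. Every hyperedge with more than two vertices contains
exactly one of the blocks, the *type* of the hyperedge. For each position `p ≤ n` of the chain there
are hyperedges of type 0 and of type 1 that contain `c p` and `c (p + 1)`; the one of type 0
also contains the marker of `p` modulo 3, the one of type 1 the two other markers. The hyperedges of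
types 2 and 3 are bare blocks. Small hyperedges join each constant to the other constants and to both
ends of the chain, and one labelled hyperedge at either end joins, after gluing, that end to the
corresponding end of the other chain.

By the Helly property of subtrees (`helly`) some bag `u` contains the constants and both chain
starts, and some bag `w` contains the constants and both chain ends; all bags between `u` and `w`
contain the constants. Counting block vertices shows that such a bag needs four hyperedges, and that
four suffice only with one of each type (`cover_eq_typedEdges`). If the bag meets both chains, then
the hyperedges of types 0 and 1 belong to different chains, and since they have to cover all markers,
their positions agree modulo 3 (`exists_positions`). Consecutive bags on the way from `u` to `w` share
a vertex of each chain, so either position changes by at most one in a step. Hence the two positions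
stay equal, and the chains have the same length (`length_eq_of_cover`). Conversely, two chains of
equal length are swept simultaneously by a path decomposition of width 4 (`Presents.ghtw_le_four`).

That the gadgets lie in the small universe is shown by naming the vertices of the generated graphs
(`Describes`, `Generated`): only the set of the hyperedges, not their multiplicities, is tracked, so
spare labels can sit at empty hyperedges, which have no influence on the width.
-/

namespace HTW

/-! ### Subtrees of a tree -/

section Tree

open SimpleGraph

variable {N : Type} {G : SimpleGraph N}

theorem exists_walk_within {s : Set N} (h : (G.induce s).Connected) {x y : N} (hx : x ∈ s)
    (hy : y ∈ s) : ∃ w : G.Walk x y, ∀ z ∈ w.support, z ∈ s := by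
  obtain ⟨w⟩ := h.preconnected ⟨x, hx⟩ ⟨y, hy⟩
  refine ⟨w.map (Embedding.induce s).toHom, fun z hz => ?_⟩
  have hz' : z ∈ (w.map (Embedding.induce s).toHom).support := hz
  rw [Walk.support_map, List.mem_map] at hz'
  obtain ⟨a, -, rfl⟩ := hz'
  exact a.2

theorem path_eq_bypass [DecidableEq N] (hG : G.IsTree) {x y : N} {P : G.Walk x y}
    (hP : P.IsPath) (w : G.Walk x y) : P = w.bypass :=
  (hG.existsUnique_path x y).unique hP w.bypass_isPath

theorem path_edges_subset (hG : G.IsTree) {x y : N} {P : G.Walk x y} (hP : P.IsPath)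
    (w : G.Walk x y) : P.edges ⊆ w.edges := by
  classical
  rw [path_eq_bypass hG hP w]
  exact w.edges_bypass_subset_edges

theorem path_support_subset (hG : G.IsTree) {x y : N} {P : G.Walk x y} (hP : P.IsPath)
    (w : G.Walk x y) : P.support ⊆ w.support := by
  classical
  rw [path_eq_bypass hG hP w]
  exact w.support_bypass_subset_support

/-- A subtree has a vertex `a` closest to a root `r`, and every path from the subtree to the root
runs inside the subtree up to `a` and then strictly closer to the root than `a`. -/
theorem exists_top (hG : G.IsTree) {s : Set N} (h : (G.induce s).Connected) (r : N) :
    ∃ a ∈ s, ∀ y ∈ s, ∀ P : G.Walk y r, P.IsPath →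
      a ∈ P.support ∧ ∀ z ∈ P.support, z ∈ s ∨ G.dist z r < G.dist a r := by
  classical
  obtain ⟨y0⟩ := h.nonempty
  have hne : ((fun z => G.dist z r) '' s).Nonempty := ⟨_, y0.1, y0.2, rfl⟩
  obtain ⟨a, ha, hmin⟩ := Nat.sInf_mem hne
  replace hmin : ∀ z ∈ s, G.dist a r ≤ G.dist z r := fun z hz => by
    have := Nat.sInf_le (Set.mem_image_of_mem (fun z => G.dist z r) hz)
    simp only at hmin
    omega
  refine ⟨a, ha, fun y hy P hP => ?_⟩
  obtain ⟨w, hw⟩ := exists_walk_within h hy ha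
  obtain ⟨Q, hQ⟩ := hG.connected.exists_walk_length_eq_dist a r
  have hQP : Q.IsPath := Q.isPath_of_length_eq_dist hQ
  have hlt : ∀ z ∈ Q.support, z = a ∨ G.dist z r < G.dist a r := by
    intro z hz
    by_cases hza : z = a
    · exact Or.inl hza
    · right
      have h1 : (Q.takeUntil z hz).length + (Q.dropUntil z hz).length = Q.length := by
        rw [← Walk.length_append, Walk.take_spec]
      have h2 : (Q.takeUntil z hz).length ≠ 0 := fun h0 => hza (Walk.eq_of_length_eq_zero h0).symm
      have h3 := dist_le (Q.dropUntil z hz)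
      omega
  have hPA : (w.bypass.append Q).IsPath := by
    rw [Walk.isPath_def, Walk.support_append, List.nodup_append]
    refine ⟨w.bypass_isPath.support_nodup, hQP.support_nodup.tail, fun z hz z' hz' hzz => ?_⟩
    subst hzz
    have hz1 := hw z (w.support_bypass_subset_support hz)
    rcases hlt z (List.mem_of_mem_tail hz') with rfl | h1
    · have := hQP.support_nodup
      rw [← Walk.cons_tail_support] at this
      exact (List.nodup_cons.1 this).1 hz'
    · exact absurd (hmin z hz1) (by omega)
  have hPe : P = w.bypass.append Q := (hG.existsUnique_path y r).unique hP hPA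
  subst hPe
  refine ⟨by simp, fun z hz => ?_⟩
  rw [Walk.mem_support_append_iff] at hz
  rcases hz with hz | hz
  · exact Or.inl (hw z (w.support_bypass_subset_support hz))
  · rcases hlt z hz with rfl | h1
    · exact Or.inl ha
    · exact Or.inr h1

/-- The Helly property of subtrees. -/
theorem helly {ι : Type} (hG : G.IsTree) (K : Set ι) (hK : K.Finite) (T : ι → Set N)
    (hT : ∀ i ∈ K, (G.induce (T i)).Connected)
    (hm : ∀ i ∈ K, ∀ j ∈ K, i ≠ j → (T i ∩ T j).Nonempty) :
    ∃ x, ∀ i ∈ K, x ∈ T i := by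
  classical
  obtain ⟨r⟩ := hG.connected.nonempty
  have : Nonempty N := ⟨r⟩
  rcases K.eq_empty_or_nonempty with rfl | hne
  · exact ⟨r, by simp⟩
  choose! a ha hab using fun i (hi : i ∈ K) => exists_top hG (hT i hi) r
  -- the subtree whose top is farthest from the root
  obtain ⟨i, hi, hmax⟩ := Set.exists_max_image K (fun i => G.dist (a i) r) hK hne
  refine ⟨a i, fun j hj => ?_⟩
  by_cases hij : i = j
  · exact hij ▸ ha i hi
  obtain ⟨y, hyi, hyj⟩ := hm i hi j hj hij
  obtain ⟨P, hP, -⟩ := hG.existsUnique_path y r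
  rcases (hab j hj y hyj P hP).2 _ (hab i hi y hyi P hP).1 with h | h
  · exact h
  · exact absurd (hmax j hj) (not_le.2 h)

/-- A chain of subtrees in which neighbours meet contains a walk between any points of its ends;
each edge of the walk lies in one subtree. -/
theorem exists_chain_walk (T : ℕ → Set N) (k : ℕ)
    (hT : ∀ i ≤ k, (G.induce (T i)).Connected)
    (hm : ∀ i < k, (T i ∩ T (i + 1)).Nonempty) {u : N} (hu : u ∈ T 0) :
    ∀ w ∈ T k, ∃ W : G.Walk u w, ∀ x y, s(x, y) ∈ W.edges → ∃ i ≤ k, x ∈ T i ∧ y ∈ T i := by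
  induction k with
  | zero =>
    intro w hw
    obtain ⟨W, hW⟩ := exists_walk_within (hT 0 le_rfl) hu hw
    exact ⟨W, fun x y h => ⟨0, le_rfl, hW _ (W.fst_mem_support_of_mem_edges h),
      hW _ (W.snd_mem_support_of_mem_edges h)⟩⟩
  | succ k ih =>
    intro w hw
    obtain ⟨v, hv, hv'⟩ := hm k (Nat.lt_succ_self k)
    obtain ⟨W, hW⟩ := ih (fun i hi => hT i (by omega)) (fun i hi => hm i (by omega)) v hv
    obtain ⟨W', hW'⟩ := exists_walk_within (hT _ le_rfl) hv' hw
    refine ⟨W.append W', fun x y h => ?_⟩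
    rw [Walk.edges_append, List.mem_append] at h
    rcases h with h | h
    · obtain ⟨i, hi, h1⟩ := hW x y h
      exact ⟨i, by omega, h1⟩
    · exact ⟨k + 1, le_rfl, hW' _ (W'.fst_mem_support_of_mem_edges h),
        hW' _ (W'.snd_mem_support_of_mem_edges h)⟩

/-- A property that passes along every edge of a walk passes from its start to its end. -/
theorem walk_induction {u w : N} (P : G.Walk u w) (Q : N → Prop) (hu : Q u)
    (h : ∀ x y, s(x, y) ∈ P.edges → Q x → Q y) : Q w := by
  induction P with
  | nil => exact hu
  | cons hadj p ih =>
    exact ih (h _ _ (by simp) hu) fun x y hxy => h x y (by simp [hxy])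

end Tree

/-! ### The hyperedges of the gadget -/

section Gadget

variable {B : Type}

/-- The constant vertices in the hyperedge of type `τ` at position `p`. The constants
`3 * τ, 3 * τ + 1, 3 * τ + 2` form the block of type `τ`; the constant `12 + j` is the marker of the
residue `j` modulo 3. Type 0 has the marker of `p`, type 1 has the two other markers. -/
def typePart (τ : Fin 4) (p : ℕ) : Set (Fin 15) :=
  {k | k.val / 3 = τ.val ∨
    k.val / 3 = 4 ∧ (τ = 0 ∧ k.val % 3 = p % 3 ∨ τ = 1 ∧ k.val % 3 ≠ p % 3)}

/-- The hyperedge of type `τ` at position `p` of the chain `c 0, c 1, …`. The types 0 and 1 contain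
the chain vertices `c p` and `c (p + 1)`, the types 2 and 3 are just blocks. -/
def typedEdge (c : ℕ → B) (τ : Fin 4) (p : ℕ) : Set (Fin 15 ⊕ B) :=
  Sum.inl '' typePart τ p ∪
    {x | τ.val ≤ 1 ∧ (x = Sum.inr (c p) ∨ x = Sum.inr (c (p + 1)))}

@[simp] theorem inl_mem_typedEdge {c : ℕ → B} {τ : Fin 4} {p : ℕ} {k : Fin 15} :
    Sum.inl k ∈ typedEdge c τ p ↔ k ∈ typePart τ p := by
  simp [typedEdge]

@[simp] theorem inr_mem_typedEdge {c : ℕ → B} {τ : Fin 4} {p : ℕ} {b : B} :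
    Sum.inr b ∈ typedEdge c τ p ↔ τ.val ≤ 1 ∧ (b = c p ∨ b = c (p + 1)) := by
  simp [typedEdge]

/-- The hyperedges of two glued gadgets with chains of lengths `ℓ true` and `ℓ false`, up to
hyperedges contained in others. -/
def gluedFamily (ℓ : Bool → ℕ) : Set (Set (Fin 15 ⊕ Bool × ℕ)) :=
  {f | (∃ h τ p, p ≤ ℓ h ∧ f = typedEdge (fun i => (h, i)) τ p) ∨
    (∃ h k z, ((∃ k', z = Sum.inl k') ∨ z = Sum.inr (h, 0) ∨ z = Sum.inr (h, ℓ h + 1)) ∧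
      f = {Sum.inl k, z}) ∨
    f = {Sum.inr (true, 0), Sum.inr (false, 0)} ∨
    f = {Sum.inr (true, ℓ true + 1), Sum.inr (false, ℓ false + 1)}}

/-- The vertices of two glued gadgets. -/
def gluedGround (ℓ : Bool → ℕ) : Set (Fin 15 ⊕ Bool × ℕ) :=
  {x | ∀ h i, x = Sum.inr (h, i) → i ≤ ℓ h + 1}

open Classical in
/-- The block vertices in a set. -/
noncomputable def blockTrace (f : Set (Fin 15 ⊕ B)) : Finset (Fin 15) :=
  Finset.univ.filter fun k => k.val < 12 ∧ Sum.inl k ∈ f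

theorem card_blockTrace_typedEdge (c : ℕ → B) (τ : Fin 4) (p : ℕ) :
    (blockTrace (typedEdge c τ p)).card ≤ 3 := by
  have h : blockTrace (typedEdge c τ p) ⊆
      Finset.univ.filter fun k : Fin 15 => k.val / 3 = τ.val := by
    intro k
    simp only [blockTrace, Finset.mem_filter, Finset.mem_univ, true_and, inl_mem_typedEdge,
      typePart, Set.mem_ofPred_eq]
    omega
  have h3 : ∀ τ : Fin 4, (Finset.univ.filter fun k : Fin 15 => k.val / 3 = τ.val).card ≤ 3 := by
    decide
  exact (Finset.card_le_card h).trans (h3 τ)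

theorem card_blockTrace_pair (x y : Fin 15 ⊕ B) : (blockTrace {x, y}).card ≤ 2 := by
  classical
  rw [← Finset.card_image_of_injective (f := (Sum.inl : Fin 15 → Fin 15 ⊕ B)) _ Sum.inl_injective]
  refine (Finset.card_le_card (t := {x, y}) fun z => ?_).trans Finset.card_le_two
  simp only [blockTrace, Finset.mem_image, Finset.mem_filter, Finset.mem_univ, true_and,
    Set.mem_insert_iff, Set.mem_singleton_iff, Finset.mem_insert, Finset.mem_singleton]
  rintro ⟨k, ⟨-, h⟩, rfl⟩
  exact h

theorem gluedFamily_cases {ℓ : Bool → ℕ} {f} (hf : f ∈ gluedFamily ℓ) :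
    (∃ h τ p, p ≤ ℓ h ∧ f = typedEdge (fun i => (h, i)) τ p) ∨ (blockTrace f).card ≤ 2 := by
  rcases hf with h | ⟨-, k, z, -, rfl⟩ | rfl | rfl
  · exact Or.inl h
  all_goals exact Or.inr (card_blockTrace_pair _ _)

theorem card_blockTrace_le {ℓ : Bool → ℕ} {f} (hf : f ∈ gluedFamily ℓ) :
    (blockTrace f).card ≤ 3 := by
  rcases gluedFamily_cases hf with ⟨h, τ, p, -, rfl⟩ | h
  · exact card_blockTrace_typedEdge _ _ _
  · omega

/-- The constants include twelve block vertices. -/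
theorem twelve_le_sum_blockTrace {C : Finset (Set (Fin 15 ⊕ B))}
    (hC : ∀ k : Fin 15, ∃ f ∈ C, Sum.inl k ∈ f) : 12 ≤ ∑ f ∈ C, (blockTrace f).card := by
  classical
  have h : (Finset.univ.filter fun k : Fin 15 => k.val < 12) ⊆ C.biUnion blockTrace := by
    intro k hk
    obtain ⟨f, hf, hkf⟩ := hC k
    simp only [Finset.mem_filter, Finset.mem_univ, true_and] at hk
    simp only [Finset.mem_biUnion, blockTrace, Finset.mem_filter, Finset.mem_univ, true_and]
    exact ⟨f, hf, hk, hkf⟩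
  exact le_trans (by decide) ((Finset.card_le_card h).trans Finset.card_biUnion_le)

theorem four_le_card_cover {ℓ : Bool → ℕ} {C : Finset (Set (Fin 15 ⊕ Bool × ℕ))}
    (hF : ∀ f ∈ C, f ∈ gluedFamily ℓ) (hC : ∀ k : Fin 15, ∃ f ∈ C, Sum.inl k ∈ f) :
    4 ≤ C.card := by
  have h1 := twelve_le_sum_blockTrace hC
  have h2 := Finset.sum_le_card_nsmul C (fun f => (blockTrace f).card) 3
    fun f hf => card_blockTrace_le (hF f hf)
  rw [smul_eq_mul] at h2
  omega

/-- Four hyperedges that cover the constants are one of each type. -/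
theorem cover_eq_typedEdges {ℓ : Bool → ℕ} {C : Finset (Set (Fin 15 ⊕ Bool × ℕ))}
    (hF : ∀ f ∈ C, f ∈ gluedFamily ℓ) (hcard : C.card ≤ 4)
    (hC : ∀ k : Fin 15, ∃ f ∈ C, Sum.inl k ∈ f) :
    ∃ (h : Fin 4 → Bool) (p : Fin 4 → ℕ), (∀ τ, p τ ≤ ℓ (h τ)) ∧
      ∀ f ∈ C, ∃ τ, f = typedEdge (fun i => (h τ, i)) τ (p τ) := by
  classical
  have h12 := twelve_le_sum_blockTrace hC
  -- the bound 12 is attained only if every member contains three block vertices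
  have h3 : ∀ f ∈ C, ¬ (blockTrace f).card ≤ 2 := by
    intro f hf h2
    have h4 := Finset.sum_le_card_nsmul (C.erase f) (fun f => (blockTrace f).card) 3
      fun g hg => card_blockTrace_le (hF g (Finset.mem_of_mem_erase hg))
    rw [smul_eq_mul, Finset.card_erase_of_mem hf] at h4
    rw [← Finset.add_sum_erase C _ hf] at h12
    omega
  have hex : ∀ τ : Fin 4, ∃ (h : Bool) (p : ℕ), p ≤ ℓ h ∧
      typedEdge (fun i => (h, i)) τ p ∈ C := by
    intro τ
    obtain ⟨f, hf, hkf⟩ := hC ⟨3 * τ.val, by omega⟩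
    rcases gluedFamily_cases (hF f hf) with ⟨h, τ', p, hp, rfl⟩ | h
    · rw [inl_mem_typedEdge] at hkf
      have : τ = τ' := by
        simp only [typePart, Set.mem_ofPred_eq] at hkf
        omega
      exact ⟨h, p, hp, this ▸ hf⟩
    · exact absurd h (h3 f hf)
  choose h p hp hmem using hex
  refine ⟨h, p, hp, ?_⟩
  have hinj : Function.Injective fun τ => typedEdge (fun i => (h τ, i)) τ (p τ) := by
    intro τ τ' hττ
    have h1 : (Sum.inl ⟨3 * τ.val, by omega⟩ : Fin 15 ⊕ Bool × ℕ) ∈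
        typedEdge (fun i => (h τ, i)) τ (p τ) := by
      simp only [inl_mem_typedEdge, typePart, Set.mem_ofPred_eq]
      omega
    simp only at hττ
    rw [hττ] at h1
    simp only [inl_mem_typedEdge, typePart, Set.mem_ofPred_eq] at h1
    omega
  have himg : Finset.univ.image (fun τ => typedEdge (fun i => (h τ, i)) τ (p τ)) = C := by
    refine Finset.eq_of_subset_of_card_le (fun f hf => ?_) ?_
    · obtain ⟨τ, -, rfl⟩ := Finset.mem_image.1 hf
      exact hmem τ
    · rw [Finset.card_image_of_injective _ hinj]
      simpa using hcard
  intro f hf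
  rw [← himg] at hf
  obtain ⟨τ, -, rfl⟩ := Finset.mem_image.1 hf
  exact ⟨τ, rfl⟩

/-- A bag that contains the constants and a vertex of either chain sees both chains at positions
that agree modulo 3: it is covered by one hyperedge of each type, those of type 0 and type 1 lie on
different chains, and their markers are complementary. -/
theorem exists_positions {ℓ : Bool → ℕ} {C : Finset (Set (Fin 15 ⊕ Bool × ℕ))}
    {X : Set (Fin 15 ⊕ Bool × ℕ)}
    (hF : ∀ f ∈ C, f ∈ gluedFamily ℓ) (hcard : C.card ≤ 4)
    (hC : ∀ x ∈ X, ∃ f ∈ C, x ∈ f) (hX : ∀ k, Sum.inl k ∈ X)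
    (hchain : ∀ h, ∃ i, Sum.inr (h, i) ∈ X) :
    ∃ p : Bool → ℕ, (∀ h, p h ≤ ℓ h) ∧ p true % 3 = p false % 3 ∧
      ∀ h i, Sum.inr (h, i) ∈ X → i = p h ∨ i = p h + 1 := by
  obtain ⟨h, p, hp, hcov⟩ := cover_eq_typedEdges hF hcard fun k => hC _ (hX k)
  have hchain' : ∀ b i, Sum.inr (b, i) ∈ X →
      (b = h 0 ∧ (i = p 0 ∨ i = p 0 + 1)) ∨ (b = h 1 ∧ (i = p 1 ∨ i = p 1 + 1)) := by
    intro b i hbi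
    obtain ⟨f, hf, hbf⟩ := hC _ hbi
    obtain ⟨τ, rfl⟩ := hcov f hf
    rw [inr_mem_typedEdge] at hbf
    simp only [Prod.mk.injEq] at hbf
    have : τ = 0 ∨ τ = 1 := by omega
    rcases this with rfl | rfl
    · left; tauto
    · right; tauto
  have hne : h 0 ≠ h 1 := by
    intro he
    obtain ⟨i, hi⟩ := hchain (!h 0)
    rcases hchain' _ _ hi with h1 | h1 <;> simp [he] at h1
  have hmod : p 0 % 3 = p 1 % 3 := by
    obtain ⟨f, hf, hkf⟩ := hC _ (hX ⟨12 + p 1 % 3, by omega⟩)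
    obtain ⟨τ, rfl⟩ := hcov f hf
    simp only [inl_mem_typedEdge, typePart, Set.mem_ofPred_eq] at hkf
    rcases hkf with h1 | ⟨-, ⟨rfl, h1⟩ | ⟨rfl, h1⟩⟩ <;> omega
  refine ⟨fun b => if b = h 0 then p 0 else p 1, fun b => ?_, ?_, fun b i hbi => ?_⟩
  · simp only
    split_ifs with hb
    · exact hb ▸ hp 0
    · have : b = h 1 := by revert hb hne; cases b <;> cases h 0 <;> cases h 1 <;> simp
      exact this ▸ hp 1
  · simp only
    split_ifs <;> omega
  · rcases hchain' b i hbi with ⟨hb, h1⟩ | ⟨hb, h1⟩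
    · simp only [hb, if_true]; exact h1
    · have : b ≠ h 0 := hb ▸ hne.symm
      simp only [this, if_false]; exact h1

end Gadget

/-! ### The lower bound -/

section LowerBound

open SimpleGraph

variable {N : Type} {G : SimpleGraph N} {ℓ : Bool → ℕ} {T : Fin 15 ⊕ Bool × ℕ → Set N}

/-- Some bag contains the constants and one end of either chain, as these form a clique. -/
theorem exists_node_constants (hG : G.IsTree)
    (hT : ∀ a ∈ gluedGround ℓ, (G.induce (T a)).Connected)
    (hm : ∀ f ∈ gluedFamily ℓ, ∀ a ∈ f, ∀ b ∈ f, a ≠ b → (T a ∩ T b).Nonempty)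
    (i : Bool → ℕ)
    (hi : (∀ h, i h = 0) ∨ (∀ h, i h = ℓ h + 1)) :
    ∃ x, (∀ k, x ∈ T (Sum.inl k)) ∧ ∀ h, x ∈ T (Sum.inr (h, i h)) := by
  have hpair : ∀ a b, a ≠ b → {a, b} ∈ gluedFamily ℓ → (T a ∩ T b).Nonempty :=
    fun a b hab hf => hm _ hf a (by simp) b (by simp) hab
  have key : ∀ (k : Fin 15) h, {Sum.inl k, Sum.inr (h, i h)} ∈ gluedFamily ℓ := by
    intro k h
    refine Or.inr (Or.inl ⟨h, k, _, Or.inr ?_, rfl⟩)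
    rcases hi with hi | hi <;> simp [hi]
  have keyc : {Sum.inr (true, i true), Sum.inr (false, i false)} ∈ gluedFamily ℓ := by
    rcases hi with hi | hi
    · simp only [hi]; exact Or.inr (Or.inr (Or.inl rfl))
    · simp only [hi]; exact Or.inr (Or.inr (Or.inr rfl))
  obtain ⟨x, hx⟩ := helly hG (Set.range fun a : Fin 15 ⊕ Bool => a.map id fun h => (h, i h))
    (Set.finite_range _) T
    (by
      rintro _ ⟨a, rfl⟩
      refine hT _ fun h j hj => ?_
      rcases a with k | b
      · simp at hj
      · simp only [Sum.map_inr, Sum.inr.injEq, Prod.mk.injEq] at hj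
        obtain ⟨rfl, rfl⟩ := hj
        rcases hi with hi | hi <;> simp [hi])
    (by
      rintro _ ⟨a, rfl⟩ _ ⟨b, rfl⟩ hab
      rcases a with k | a <;> rcases b with k' | b
      · exact hpair _ _ hab (Or.inr (Or.inl ⟨true, k, _, Or.inl ⟨k', rfl⟩, rfl⟩))
      · exact hpair _ _ hab (key k b)
      · rw [Set.inter_comm]
        exact hpair _ _ hab.symm (key k' a)
      · cases a <;> cases b
        · exact absurd rfl hab
        · rw [Set.inter_comm]
          exact hpair _ _ hab.symm keyc
        · exact hpair _ _ hab keyc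
        · exact absurd rfl hab)
  exact ⟨x, fun k => hx _ ⟨Sum.inl k, rfl⟩, fun h => hx _ ⟨Sum.inr h, rfl⟩⟩

/-- If two glued gadgets have a tree decomposition of cover width 4, then their chains have equal
lengths: along the path between the bags of the chain ends, the positions on the two chains change
by at most one in each step and agree modulo 3, so they stay equal. -/
theorem length_eq_of_cover (hG : G.IsTree)
    (hT : ∀ a ∈ gluedGround ℓ, (G.induce (T a)).Connected)
    (hm : ∀ f ∈ gluedFamily ℓ, ∀ a ∈ f, ∀ b ∈ f, a ≠ b → (T a ∩ T b).Nonempty)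
    (hcov : ∀ x, ∃ C : Finset (Set (Fin 15 ⊕ Bool × ℕ)), C.card ≤ 4 ∧
      (∀ f ∈ C, f ∈ gluedFamily ℓ) ∧ ∀ a, x ∈ T a → ∃ f ∈ C, a ∈ f) :
    ℓ true = ℓ false := by
  obtain ⟨u, hu, huc⟩ := exists_node_constants hG hT hm (fun _ => 0) (Or.inl fun _ => rfl)
  obtain ⟨w, hw, hwc⟩ := exists_node_constants hG hT hm (fun h => ℓ h + 1) (Or.inr fun _ => rfl)
  obtain ⟨P, hP, -⟩ := hG.existsUnique_path u w
  have hground : ∀ k : Fin 15, (Sum.inl k : Fin 15 ⊕ Bool × ℕ) ∈ gluedGround ℓ :=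
    fun k h i hk => by simp at hk
  have hconst : ∀ x ∈ P.support, ∀ k, x ∈ T (Sum.inl k) := by
    intro x hx k
    obtain ⟨W, hW⟩ := exists_walk_within (hT _ (hground k)) (hu k) (hw k)
    exact hW x (path_support_subset hG hP W hx)
  have hshare : ∀ h x y, s(x, y) ∈ P.edges →
      ∃ i, x ∈ T (Sum.inr (h, i)) ∧ y ∈ T (Sum.inr (h, i)) := by
    intro h x y hxy
    obtain ⟨W, hW⟩ := exists_chain_walk (fun i => T (Sum.inr (h, i))) (ℓ h + 1)
      (fun i hi => hT _ fun h' j hj => by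
        simp only [Sum.inr.injEq, Prod.mk.injEq] at hj
        obtain ⟨rfl, rfl⟩ := hj
        exact hi)
      (fun i hi => hm (typedEdge (fun i => (h, i)) 0 i)
        (Or.inl ⟨h, 0, i, by omega, rfl⟩) _ (by simp) _ (by simp) (by simp))
      (huc h) w (hwc h)
    obtain ⟨i, -, h1⟩ := hW x y (path_edges_subset hG hP W hxy)
    exact ⟨i, h1⟩
  have hpos : ∀ x ∈ P.support, (∀ h, ∃ i, x ∈ T (Sum.inr (h, i))) →
      ∃ p : Bool → ℕ, (∀ h, p h ≤ ℓ h) ∧ p true % 3 = p false % 3 ∧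
        ∀ h i, x ∈ T (Sum.inr (h, i)) → i = p h ∨ i = p h + 1 := by
    intro x hx hch
    obtain ⟨C, hcard, hF, hC⟩ := hcov x
    exact exists_positions (X := {a | x ∈ T a}) hF hcard hC (hconst x hx) hch
  obtain ⟨-, -, p, hp, hpq, hpw⟩ := walk_induction P
    (fun x => x ∈ P.support ∧ (∀ h, ∃ i, x ∈ T (Sum.inr (h, i))) ∧
      ∃ p : Bool → ℕ, (∀ h, p h ≤ ℓ h) ∧ p true = p false ∧
        ∀ h i, x ∈ T (Sum.inr (h, i)) → i = p h ∨ i = p h + 1)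
    (by
      have hch : ∀ h, ∃ i, u ∈ T (Sum.inr (h, i)) := fun h => ⟨0, huc h⟩
      refine ⟨P.start_mem_support, hch, ?_⟩
      obtain ⟨p, hp, -, hpu⟩ := hpos u P.start_mem_support hch
      refine ⟨p, hp, ?_, hpu⟩
      have h1 := hpu true 0 (huc true)
      have h2 := hpu false 0 (huc false)
      omega)
    (by
      rintro x y hxy ⟨hx, -, p, -, hpq, hpx⟩
      choose i hix hiy using fun h => hshare h x y hxy
      have hy := P.snd_mem_support_of_mem_edges hxy
      refine ⟨hy, fun h => ⟨i h, hiy h⟩, ?_⟩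
      obtain ⟨q, hq, hmod, hqy⟩ := hpos y hy fun h => ⟨i h, hiy h⟩
      refine ⟨q, hq, ?_, hqy⟩
      have h1 := hpx true _ (hix true)
      have h2 := hpx false _ (hix false)
      have h3 := hqy true _ (hiy true)
      have h4 := hqy false _ (hiy false)
      omega)
  have h1 := hpw true _ (hwc true)
  have h2 := hpw false _ (hwc false)
  have h3 := hp true
  have h4 := hp false
  omega

end LowerBound

/-! ### Generalized hypertree width of presented hypergraphs -/

section Width

open SimpleGraph

theorem MultiHypergraph.HasCoverDecomposition.mono {H : MultiHypergraph} {k l : ℕ} (hkl : k ≤ l)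
    (h : H.HasCoverDecomposition k) : H.HasCoverDecomposition l := by
  obtain ⟨D, hD⟩ := h
  refine ⟨D, fun x => ?_⟩
  obtain ⟨C, hC, hcov⟩ := hD x
  exact ⟨C, hC.trans hkl, hcov⟩

/-- A single bag is a tree decomposition. Thus the width is an actual minimum and not the junk value
`sInf ∅ = 0`. -/
theorem MultiHypergraph.exists_hasCoverDecomposition (H : MultiHypergraph)
    (hH : ∀ v, ∃ e, v ∈ H.inc e) : ∃ k, H.HasCoverDecomposition k := by
  classical
  have := H.finE
  have := Fintype.ofFinite H.E
  let D : TreeDecomposition H.primalGraph :=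
    { Node := Unit
      finNode := inferInstance
      tree := ⊥
      isTree := IsTree.of_subsingleton
      bag := fun _ => Set.univ
      vertex_mem := fun _ => ⟨(), trivial⟩
      edge_mem := fun _ _ _ => ⟨(), trivial, trivial⟩
      subtree := fun v => by
        have : Nonempty {x : Unit | v ∈ (Set.univ : Set H.V)} := ⟨⟨(), trivial⟩⟩
        exact IsTree.of_subsingleton.connected }
  exact ⟨_, D, fun x => ⟨Finset.univ, le_rfl, fun v _ => by
    obtain ⟨e, he⟩ := hH v
    exact ⟨e, Finset.mem_univ e, he⟩⟩⟩

theorem MultiHypergraph.ghtw_le_iff (H : MultiHypergraph) (k : ℕ) :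
    H.ghtw ≤ k ↔ H.removeIsolated.HasCoverDecomposition k := by
  constructor
  · intro h
    have hne : {k | H.removeIsolated.HasCoverDecomposition k}.Nonempty :=
      H.removeIsolated.exists_hasCoverDecomposition fun v => v.2
    exact MultiHypergraph.HasCoverDecomposition.mono h (Nat.sInf_mem hne)
  · exact fun h => Nat.sInf_le h

/-- `ψ` identifies the vertices of `H` with the set `S`, such that every hyperedge of `H` is
contained in a member of `F` and vice versa. -/
structure Presents {A : Type} (H : MultiHypergraph) (S : Set A) (F : Set (Set A))
    (ψ : H.V → A) : Prop where
  inj : Function.Injective ψ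
  range : Set.range ψ = S
  le : ∀ e, ∃ f ∈ F, ψ '' H.inc e ⊆ f
  ge : ∀ f ∈ F, ∃ e, f ⊆ ψ '' H.inc e

variable {A : Type} {H : MultiHypergraph} {S : Set A} {F : Set (Set A)} {ψ : H.V → A}

theorem Presents.removeIsolated (h : Presents H S F ψ) (hSF : ∀ a ∈ S, ∃ f ∈ F, a ∈ f) :
    Presents H.removeIsolated S F (fun v => ψ v.1) where
  inj := h.inj.comp Subtype.val_injective
  range := by
    rw [← h.range]
    apply Set.Subset.antisymm
    · rintro _ ⟨v, rfl⟩
      exact ⟨v.1, rfl⟩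
    · rintro _ ⟨v, rfl⟩
      obtain ⟨f, hf, hv⟩ := hSF (ψ v) (h.range ▸ ⟨v, rfl⟩)
      obtain ⟨e, he⟩ := h.ge f hf
      obtain ⟨v', hv', hvv⟩ := he hv
      exact ⟨⟨v, e, h.inj hvv ▸ hv'⟩, rfl⟩
  le e := by
    obtain ⟨f, hf, hef⟩ := h.le e
    refine ⟨f, hf, ?_⟩
    rintro _ ⟨v, hv, rfl⟩
    exact hef ⟨v.1, hv, rfl⟩
  ge f hf := by
    obtain ⟨e, he⟩ := h.ge f hf
    refine ⟨e, fun a ha => ?_⟩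
    obtain ⟨v, hv, rfl⟩ := he ha
    exact ⟨⟨v, e, hv⟩, hv, rfl⟩

/-- A tree decomposition in terms of names: the subtrees of the vertices, and covers of the bags. -/
theorem Presents.exists_subtrees (h : Presents H S F ψ) {k : ℕ}
    (hk : H.HasCoverDecomposition k) :
    ∃ (N : Type) (G : SimpleGraph N) (T : A → Set N), G.IsTree ∧
      (∀ a ∈ S, (G.induce (T a)).Connected) ∧
      (∀ f ∈ F, ∀ a ∈ f, ∀ b ∈ f, a ≠ b → (T a ∩ T b).Nonempty) ∧
      ∀ x, ∃ C : Finset (Set A), C.card ≤ k ∧ (∀ f ∈ C, f ∈ F) ∧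
        ∀ a, x ∈ T a → ∃ f ∈ C, a ∈ f := by
  classical
  obtain ⟨D, hD⟩ := hk
  refine ⟨D.Node, D.tree, fun a => {x | ∃ v ∈ D.bag x, ψ v = a}, D.isTree, ?_, ?_, ?_⟩
  · intro a ha
    rw [← h.range] at ha
    obtain ⟨v, rfl⟩ := ha
    have : {x | ∃ v' ∈ D.bag x, ψ v' = ψ v} = {x | v ∈ D.bag x} := by
      ext x
      constructor
      · rintro ⟨v', hv', hvv⟩
        exact h.inj hvv ▸ hv'
      · exact fun hv => ⟨v, hv, rfl⟩
    beta_reduce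
    rw [this]
    exact D.subtree v
  · intro f hf a ha b hb hab
    obtain ⟨e, he⟩ := h.ge f hf
    obtain ⟨u, hu, rfl⟩ := he ha
    obtain ⟨v, hv, rfl⟩ := he hb
    obtain ⟨x, hx, hx'⟩ := D.edge_mem u v ⟨fun huv => hab (huv ▸ rfl), e, hu, hv⟩
    exact ⟨x, ⟨u, hx, rfl⟩, ⟨v, hx', rfl⟩⟩
  · intro x
    obtain ⟨C, hC, hcov⟩ := hD x
    choose g hgF hg using h.le
    refine ⟨C.image g, Finset.card_image_le.trans hC, fun f hf => ?_, ?_⟩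
    · obtain ⟨e, -, rfl⟩ := Finset.mem_image.1 hf
      exact hgF e
    · rintro _ ⟨v, hv, rfl⟩
      obtain ⟨e, he, hve⟩ := hcov v hv
      exact ⟨g e, Finset.mem_image_of_mem g he, hg e ⟨v, hve, rfl⟩⟩

theorem Presents.hasCoverDecomposition (h : Presents H S F ψ) {k : ℕ} {N : Type} [Finite N]
    {G : SimpleGraph N} (hG : G.IsTree) (bag : N → Set A)
    (hT : ∀ a ∈ S, (G.induce {x | a ∈ bag x}).Connected)
    (hm : ∀ f ∈ F, ∃ x, f ⊆ bag x)
    (hcov : ∀ x, ∃ C : Finset (Set A), C.card ≤ k ∧ (∀ f ∈ C, f ∈ F) ∧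
      ∀ a ∈ bag x, ∃ f ∈ C, a ∈ f) : H.HasCoverDecomposition k := by
  classical
  have hS : ∀ v, ψ v ∈ S := fun v => h.range ▸ ⟨v, rfl⟩
  let D : TreeDecomposition H.primalGraph :=
    { Node := N
      finNode := inferInstance
      tree := G
      isTree := hG
      bag := fun x => {v | ψ v ∈ bag x}
      vertex_mem := fun v => by
        obtain ⟨x, hx⟩ := (hT _ (hS v)).nonempty
        exact ⟨x, hx⟩
      edge_mem := by
        rintro u v ⟨-, e, hu, hv⟩
        obtain ⟨f, hf, hef⟩ := h.le e
        obtain ⟨x, hx⟩ := hm f hf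
        exact ⟨x, hx (hef ⟨u, hu, rfl⟩), hx (hef ⟨v, hv, rfl⟩)⟩
      subtree := fun v => hT _ (hS v) }
  refine ⟨D, fun x => ?_⟩
  obtain ⟨C, hC, hCF, hcov⟩ := hcov x
  choose g hg using h.ge
  refine ⟨C.attach.image fun f => g f.1 (hCF f.1 f.2),
    Finset.card_image_le.trans (by rwa [Finset.card_attach]), fun v hv => ?_⟩
  obtain ⟨f, hf, hvf⟩ := hcov _ hv
  obtain ⟨v', hv', hvv⟩ := hg f (hCF f hf) hvf
  exact ⟨_, Finset.mem_image_of_mem _ (Finset.mem_attach C ⟨f, hf⟩), h.inj hvv ▸ hv'⟩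

/-! ### Path decompositions -/

theorem isTree_pathGraph (n : ℕ) : (pathGraph (n + 1)).IsTree := by
  refine ⟨pathGraph_connected n, ?_⟩
  rw [isAcyclic_iff_forall_adj_isBridge]
  have key : ∀ u v : Fin (n + 1), u.val + 1 = v.val → (pathGraph (n + 1)).IsBridge s(u, v) := by
    intro u v huv
    rw [isBridge_iff]
    rintro ⟨w⟩
    -- once the edge is removed, no walk passes from below it to above it
    have : v.val ≤ u.val := walk_induction w (fun x => x.val ≤ u.val) le_rfl (by
      intro x y hxy hx
      have hadj := w.adj_of_mem_edges hxy
      rw [deleteEdges_adj, pathGraph_adj] at hadj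
      by_contra hy
      have hxu : x = u := Fin.ext (by omega)
      have hyv : y = v := Fin.ext (by omega)
      exact hadj.2 (by rw [hxu, hyv]; rfl))
    omega
  intro u v huv
  rcases pathGraph_adj.1 huv with h | h
  · exact key u v h
  · rw [Sym2.eq_swap]
    exact key v u h

/-- An interval of at most two nodes of a path is connected. -/
theorem pathGraph_induce_connected {n i : ℕ} (hi : i ≤ n + 1) :
    ((pathGraph (n + 1)).induce {p : Fin (n + 1) | i = p.val ∨ i = p.val + 1}).Connected := by
  have hadj : ∀ a b : {p : Fin (n + 1) | i = p.val ∨ i = p.val + 1}, a ≠ b →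
      ((pathGraph (n + 1)).induce _).Adj a b := by
    rintro ⟨a, ha⟩ ⟨b, hb⟩ hab
    simp only [Set.mem_ofPred_eq] at ha hb
    have : a.val ≠ b.val := fun h => hab (Subtype.ext (Fin.ext h))
    simp only [comap_adj, Function.Embedding.subtype_apply, pathGraph_adj]
    omega
  have : Nonempty {p : Fin (n + 1) | i = p.val ∨ i = p.val + 1} :=
    ⟨⟨⟨i - 1, by omega⟩, by simp only [Set.mem_ofPred_eq]; omega⟩⟩
  refine ⟨fun a b => ?_⟩
  by_cases hab : a = b
  · exact hab ▸ Reachable.refl _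
  · exact (hadj a b hab).reachable

end Width

/-! ### The width of two glued gadgets -/

section GluedWidth

open SimpleGraph

variable {H : MultiHypergraph} {ℓ : Bool → ℕ} {ψ : H.V → Fin 15 ⊕ Bool × ℕ}

theorem exists_mem_gluedFamily {a} (ha : a ∈ gluedGround ℓ) :
    ∃ f ∈ gluedFamily ℓ, a ∈ f := by
  rcases a with k | ⟨h, i⟩
  · exact ⟨_, Or.inr (Or.inl ⟨true, k, _, Or.inl ⟨k, rfl⟩, rfl⟩), by simp⟩
  · have := ha h i rfl
    exact ⟨_, Or.inl ⟨h, 0, i - 1, by omega, rfl⟩, by simp; omega⟩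

theorem Presents.length_eq (h : Presents H (gluedGround ℓ) (gluedFamily ℓ) ψ)
    (h4 : H.ghtw ≤ 4) : ℓ true = ℓ false := by
  obtain ⟨N, G, T, hG, hT, hm, hcov⟩ :=
    (h.removeIsolated fun _ => exists_mem_gluedFamily).exists_subtrees ((H.ghtw_le_iff 4).1 h4)
  exact length_eq_of_cover hG hT hm hcov

theorem Presents.four_le_ghtw (h : Presents H (gluedGround ℓ) (gluedFamily ℓ) ψ) :
    4 ≤ H.ghtw := by
  obtain ⟨N, G, T, hG, hT, hm, hcov⟩ :=
    (h.removeIsolated fun _ => exists_mem_gluedFamily).exists_subtrees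
      ((H.ghtw_le_iff _).1 le_rfl)
  obtain ⟨x, hx, -⟩ := exists_node_constants hG hT hm (fun _ => 0) (Or.inl fun _ => rfl)
  obtain ⟨C, hcard, hF, hC⟩ := hcov x
  exact (four_le_card_cover hF fun k => hC _ (hx k)).trans hcard

theorem Presents.ghtw_le_four {n : ℕ}
    (h : Presents H (gluedGround fun _ => n) (gluedFamily fun _ => n) ψ) : H.ghtw ≤ 4 := by
  classical
  rw [H.ghtw_le_iff]
  refine (h.removeIsolated fun _ => exists_mem_gluedFamily).hasCoverDecomposition
    (isTree_pathGraph n)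
    (fun p => {x | ∀ h i, x = Sum.inr (h, i) → i = p.val ∨ i = p.val + 1}) ?_ ?_ ?_
  · rintro (k | ⟨b, i⟩) ha
    · have : {p : Fin (n + 1) | (Sum.inl k : Fin 15 ⊕ Bool × ℕ) ∈
          {x | ∀ h i, x = Sum.inr (h, i) → i = p.val ∨ i = p.val + 1}} = Set.univ := by
        ext p
        simp
      rw [this]
      exact (Iso.connected_iff (induceUnivIso _)).2 (pathGraph_connected n)
    · have : {p : Fin (n + 1) | (Sum.inr (b, i) : Fin 15 ⊕ Bool × ℕ) ∈
          {x | ∀ h i, x = Sum.inr (h, i) → i = p.val ∨ i = p.val + 1}} =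
          {p | i = p.val ∨ i = p.val + 1} := by
        ext p
        refine ⟨fun hp => hp b i rfl, fun hp b' i' hi => ?_⟩
        cases hi
        exact hp
      rw [this]
      exact pathGraph_induce_connected (ha b i rfl)
  · rintro f (⟨b, τ, p, hp, rfl⟩ | ⟨b, k, z, hz, rfl⟩ | rfl | rfl)
    · refine ⟨⟨p, Nat.lt_succ_of_le hp⟩, ?_⟩
      rintro x hx b i rfl
      rw [inr_mem_typedEdge] at hx
      simp only [Prod.mk.injEq] at hx
      tauto
    · rcases hz with ⟨k', rfl⟩ | rfl | rfl
      · exact ⟨0, by rintro x (rfl | rfl) <;> simp⟩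
      · exact ⟨0, by rintro x (rfl | rfl) <;> simp⟩
      · exact ⟨Fin.last n, by rintro x (rfl | rfl) <;> simp⟩
    · exact ⟨0, by rintro x (rfl | rfl) <;> simp⟩
    · exact ⟨Fin.last n, by rintro x (rfl | rfl) <;> simp⟩
  · intro p
    -- type 0 from the first chain and type 1 from the second: their markers are complementary
    refine ⟨Finset.univ.image fun τ : Fin 4 =>
      typedEdge (fun i => (decide (τ = 0), i)) τ p.val, Finset.card_image_le, ?_, ?_⟩
    · intro f hf
      obtain ⟨τ, -, rfl⟩ := Finset.mem_image.1 hf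
      exact Or.inl ⟨_, τ, p.val, Nat.le_of_lt_succ p.2, rfl⟩
    · intro a ha
      suffices hτ : ∃ τ : Fin 4, a ∈ typedEdge (fun i => (decide (τ = 0), i)) τ p.val by
        obtain ⟨τ, hτ⟩ := hτ
        exact ⟨_, Finset.mem_image_of_mem _ (Finset.mem_univ τ), hτ⟩
      rcases a with k | ⟨b, i⟩
      · simp only [inl_mem_typedEdge, typePart, Set.mem_ofPred_eq]
        by_cases hk : k.val < 12
        · exact ⟨⟨k.val / 3, by omega⟩, Or.inl rfl⟩
        · by_cases hkp : k.val % 3 = p.val % 3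
          · exact ⟨0, by omega⟩
          · exact ⟨1, by omega⟩
      · have := ha b i rfl
        simp only [inr_mem_typedEdge, Prod.mk.injEq]
        cases b
        · exact ⟨1, by simp; omega⟩
        · exact ⟨0, by simp; omega⟩

end GluedWidth

/-! ### Derived parsing operators -/

section Parsing

variable {t : ℕ}

/-- The graph is the value of an expression over the parsing operators. -/
def Parsable (G : BdGraph t) : Prop := ∃ p, Parses p G

theorem BdGraph.relabel_relabel (G : BdGraph t) (σ τ : Equiv.Perm (Fin t)) :
    (G.relabel σ).relabel τ = G.relabel (σ * τ) := rfl

/-- The shift and the swap generate all permutations of the labels. -/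
theorem Parsable.relabel (ht : 2 ≤ t) {G : BdGraph t} (hG : Parsable G)
    (σ : Equiv.Perm (Fin t)) : Parsable (G.relabel σ) := by
  obtain ⟨s, rfl⟩ := Nat.exists_eq_add_of_le' ht
  let M : Submonoid (Equiv.Perm (Fin (s + 2))) :=
    { carrier := {σ | ∀ G : BdGraph (s + 2), Parsable G → Parsable (G.relabel σ)}
      one_mem' := fun G hG => hG
      mul_mem' := fun {σ τ} hσ hτ G hG => by
        rw [← BdGraph.relabel_relabel]
        exact hτ _ (hσ _ hG) }
  have h1 : finRotate (s + 2) ∈ M := fun G ⟨p, hp⟩ => ⟨_, Parses.shift hp⟩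
  have h2 : Equiv.swap (0 : Fin (s + 2)) (finRotate (s + 2) 0) ∈ M := by
    rintro G ⟨p, hp⟩
    refine ⟨.node₁ .swap p, ?_⟩
    have h3 := Parses.swap hp
    rw [BdGraph.swap, dif_pos ht] at h3
    have h4 : finRotate (s + 2) 0 = ⟨1, by omega⟩ := by simp
    rw [h4]
    exact h3
  have h3 := Equiv.Perm.closure_cycle_adjacent_swap isCycle_finRotate support_finRotate
    (0 : Fin (s + 2))
  have h4 : σ ∈ (Subgroup.closure
      {finRotate (s + 2), Equiv.swap (0 : Fin (s + 2)) (finRotate (s + 2) 0)}).toSubmonoid := by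
    rw [h3]
    trivial
  rw [Subgroup.closure_toSubmonoid_of_finite] at h4
  refine (Submonoid.closure_le.2 ?_ h4 : σ ∈ M) G hG
  rintro τ (rfl | rfl)
  · exact h1
  · exact h2

/-- Join the vertex labelled `i` to all vertices with labels in `J`. -/
def BdGraph.addEdges (G : BdGraph t) (i : Fin t) (J : Set (Fin t)) : BdGraph t where
  V := G.V
  finV := G.finV
  graph := G.graph ⊔ SimpleGraph.fromRel fun u v => u = G.lab i ∧ ∃ j ∈ J, v = G.lab j
  color := G.color
  lab := G.lab

theorem BdGraph.addEdges_adj (G : BdGraph t) (i : Fin t) (J : Set (Fin t)) (u v : G.V) :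
    (G.addEdges i J).graph.Adj u v ↔ G.graph.Adj u v ∨ u ≠ v ∧
      ((u = G.lab i ∧ ∃ j ∈ J, v = G.lab j) ∨ (v = G.lab i ∧ ∃ j ∈ J, u = G.lab j)) :=
  Iff.rfl

theorem BdGraph.ext_graph {V : Type} {h : Finite V} {g g' : SimpleGraph V} {c : V → Fin 2}
    {l l' : Fin t ↪ V} (hg : g = g') (hl : l = l') :
    (⟨V, h, g, c, l⟩ : BdGraph t) = ⟨V, h, g', c, l'⟩ := by
  rw [hg, hl]

theorem Parsable.addEdges_singleton (ht : 2 ≤ t) {G : BdGraph t} (hG : Parsable G)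
    {i j : Fin t} (hij : i ≠ j) : Parsable (G.addEdges i {j}) := by
  let z : Fin t := ⟨0, by omega⟩
  let o : Fin t := ⟨1, by omega⟩
  have hzo : z ≠ o := by simp [z, o]
  -- a permutation that takes the first two labels to `i` and `j`
  obtain ⟨σ, hz, ho⟩ : ∃ σ : Equiv.Perm (Fin t), σ z = i ∧ σ o = j := by
    refine ⟨Equiv.swap (Equiv.swap z i o) j * Equiv.swap z i, ?_, by simp⟩
    rw [Equiv.Perm.mul_apply, Equiv.swap_apply_left]
    refine Equiv.swap_apply_of_ne_of_ne ?_ hij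
    intro h
    exact hzo ((Equiv.swap z i).injective (by rw [Equiv.swap_apply_left, ← h]))
  have h1 : Parsable (G.relabel σ).addEdge := by
    obtain ⟨p, hp⟩ := hG.relabel ht σ
    exact ⟨_, Parses.edge hp⟩
  have h2 : ((G.relabel σ).addEdge.relabel σ⁻¹) = G.addEdges i {j} := by
    refine BdGraph.ext_graph ?_ ?_
    · refine congrArg (fun r => G.graph ⊔ SimpleGraph.fromRel r) ?_
      funext u v
      refine propext ⟨?_, ?_⟩
      · rintro ⟨a, b, ha, hb, rfl, rfl⟩
        obtain rfl : a = z := Fin.ext ha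
        obtain rfl : b = o := Fin.ext hb
        exact ⟨congrArg G.lab hz, j, rfl, congrArg G.lab ho⟩
      · rintro ⟨rfl, _, rfl, rfl⟩
        exact ⟨z, o, rfl, rfl, congrArg G.lab hz.symm, congrArg G.lab ho.symm⟩
    · ext k
      exact congrArg G.lab (σ.apply_symm_apply k)
  exact h2 ▸ h1.relabel ht σ⁻¹

theorem Parsable.addEdges (ht : 2 ≤ t) {G : BdGraph t} (hG : Parsable G)
    {i : Fin t} {J : Set (Fin t)} (hi : i ∉ J) : Parsable (G.addEdges i J) := by
  induction J, J.toFinite using Set.Finite.induction_on with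
  | empty =>
    convert hG
    refine BdGraph.ext_graph ?_ rfl
    ext u v
    simp [SimpleGraph.fromRel_adj]
  | @insert j J _ _ ih =>
    have h1 := (ih fun h => hi (Set.mem_insert_of_mem _ h)).addEdges_singleton ht
      (i := i) (j := j) (fun h => hi (h ▸ Set.mem_insert _ _))
    convert h1 using 1
    refine BdGraph.ext_graph ?_ rfl
    ext u v
    let joined (K : Set (Fin t)) : Prop :=
      u ≠ v ∧ ((u = G.lab i ∧ ∃ k ∈ K, v = G.lab k) ∨ (v = G.lab i ∧ ∃ k ∈ K, u = G.lab k))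
    change G.graph.Adj u v ∨ joined (insert j J) ↔ (G.graph.Adj u v ∨ joined J) ∨ joined {j}
    simp only [joined, Set.mem_insert_iff, Set.mem_singleton_iff, exists_eq_left,
      exists_eq_or_imp]
    rw [or_assoc, ← and_or_left]
    refine or_congr_right (and_congr_right fun _ => ?_)
    constructor
    · rintro (⟨hu, hv | hv⟩ | ⟨hu, hv | hv⟩)
      exacts [Or.inr (Or.inl ⟨hu, hv⟩), Or.inl (Or.inl ⟨hu, hv⟩), Or.inr (Or.inr ⟨hu, hv⟩),
        Or.inl (Or.inr ⟨hu, hv⟩)]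
    · rintro ((⟨hu, hv⟩ | ⟨hu, hv⟩) | (⟨hu, hv⟩ | ⟨hu, hv⟩))
      exacts [Or.inl ⟨hu, Or.inr hv⟩, Or.inr ⟨hu, Or.inr hv⟩, Or.inl ⟨hu, Or.inl hv⟩,
        Or.inr ⟨hu, Or.inl hv⟩]

end Parsing

/-! ### Hypergraphs generated by the parsing operators -/

section Generated

variable {t : ℕ} {A : Type}

/-- The names under `φ` of the neighbors of `w`. -/
def BdGraph.nbr (G : BdGraph t) (φ : G.V → A) (w : G.V) : Set A := φ '' {v | G.graph.Adj w v}

/-- The names `φ` describe the hypergraph of `G`: its vertices get the names in `S`, its hyperedges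
are the sets in `F`, and `lab` tells which vertex or hyperedge has a given label. The values of `φ`
at the vertices of color 2 are irrelevant. -/
structure Describes (G : BdGraph t) (φ : G.V → A) (S : Set A) (F : Set (Set A))
    (lab : Fin t → A ⊕ Set A) : Prop where
  wellColored : G.WellColored
  inj : ∀ u v, G.color u = 0 → G.color v = 0 → φ u = φ v → u = v
  mem_verts : ∀ a, a ∈ S ↔ ∃ v, G.color v = 0 ∧ φ v = a
  mem_edges : ∀ f, f ∈ F ↔ ∃ w, G.color w = 1 ∧ G.nbr φ w = f
  lab_inl : ∀ i a, lab i = Sum.inl a → G.color (G.lab i) = 0 ∧ φ (G.lab i) = a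
  lab_inr : ∀ i f, lab i = Sum.inr f → G.color (G.lab i) = 1 ∧ G.nbr φ (G.lab i) = f

/-- The hypergraph with vertices `S`, hyperedges `F` and labels `lab` comes from a graph that the
parsing operators generate. Multiplicities of hyperedges are left open. -/
def Generated (S : Set A) (F : Set (Set A)) (lab : Fin t → A ⊕ Set A) : Prop :=
  ∃ (G : BdGraph t) (φ : G.V → A), Parsable G ∧ Describes G φ S F lab

variable {S : Set A} {F : Set (Set A)} {lab : Fin t → A ⊕ Set A}

theorem Generated.relabel (ht : 2 ≤ t) (h : Generated S F lab) (σ : Equiv.Perm (Fin t)) :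
    Generated S F (lab ∘ σ) := by
  obtain ⟨G, φ, hG, hd⟩ := h
  exact ⟨G.relabel σ, φ, hG.relabel ht σ,
    { wellColored := hd.wellColored
      inj := hd.inj
      mem_verts := hd.mem_verts
      mem_edges := hd.mem_edges
      lab_inl := fun i => hd.lab_inl (σ i)
      lab_inr := fun i => hd.lab_inr (σ i) }⟩

theorem newVertex_adj (G : BdGraph t) (ℓ : Fin 2) (x y : Option G.V) :
    (G.newVertex ℓ).graph.Adj x y ↔ ∃ a b, G.graph.Adj a b ∧ x = some a ∧ y = some b := by
  simp only [BdGraph.newVertex, SimpleGraph.fromRel_adj]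
  constructor
  · rintro ⟨-, ⟨a, b, h, rfl, rfl⟩ | ⟨a, b, h, rfl, rfl⟩⟩
    · exact ⟨a, b, h, rfl, rfl⟩
    · exact ⟨b, a, h.symm, rfl, rfl⟩
  · rintro ⟨a, b, h, rfl, rfl⟩
    exact ⟨by simpa using h.ne, Or.inl ⟨a, b, h, rfl, rfl⟩⟩

theorem update_comp_swap {α : Type} {i j : Fin t} (l : Fin t → α) (x : α) :
    Function.update (l ∘ Equiv.swap i j) i x ∘ Equiv.swap i j = Function.update l j x := by
  funext k
  by_cases hk : k = j
  · subst hk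
    simp
  · have : Equiv.swap i j k ≠ i := by
      intro h
      exact hk ((Equiv.swap i j).injective (h.trans (Equiv.swap_apply_right i j).symm))
    simp [Function.update_of_ne this, Function.update_of_ne hk]

theorem Generated.newVertex (ht : 2 ≤ t) (h : Generated S F lab) (i : Fin t) {a : A}
    (ha : a ∉ S) : Generated (insert a S) F (Function.update lab i (Sum.inl a)) := by
  let z : Fin t := ⟨0, by omega⟩
  suffices key : ∀ lab : Fin t → A ⊕ Set A, Generated S F lab →
      Generated (insert a S) F (Function.update lab z (Sum.inl a)) by
    have h1 := (key _ (h.relabel ht (Equiv.swap z i))).relabel ht (Equiv.swap z i)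
    rwa [update_comp_swap] at h1
  rintro lab ⟨G, φ, ⟨p, hp⟩, hd⟩
  let φ' : (G.newVertex 0).V → A := fun v => Option.elim v a φ
  have hnbr : ∀ w, (G.newVertex 0).nbr φ' (some w) = G.nbr φ w := by
    intro w
    ext b
    constructor
    · rintro ⟨v, hv, rfl⟩
      obtain ⟨w', v, hv, h1, rfl⟩ := (newVertex_adj G 0 _ _).1 hv
      cases h1
      exact ⟨v, hv, rfl⟩
    · rintro ⟨v, hv, rfl⟩
      exact ⟨some v, (newVertex_adj G 0 _ _).2 ⟨w, v, hv, rfl, rfl⟩, rfl⟩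
  have hφ : ∀ v, G.color v = 0 → φ v ≠ a := fun v hv h =>
    ha ((hd.mem_verts a).2 ⟨v, hv, h⟩)
  have hlz : (G.newVertex 0).lab z = none := rfl
  have hl : ∀ j, j ≠ z → (G.newVertex 0).lab j = some (G.lab j) := fun j hj =>
    if_neg fun h => hj (Fin.ext h)
  refine ⟨G.newVertex 0, φ', ⟨_, Parses.newVertex 0 hp⟩, ⟨?_, ?_, ?_, ?_, ?_, ?_⟩⟩
  · intro x y hxy
    obtain ⟨u, v, huv, rfl, rfl⟩ := (newVertex_adj G 0 _ _).1 hxy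
    exact hd.wellColored u v huv
  · rintro (_ | u) (_ | v) hu hv huv
    · rfl
    · exact absurd huv.symm (hφ v hv)
    · exact absurd huv (hφ u hu)
    · exact congrArg some (hd.inj u v hu hv huv)
  · intro b
    rw [Set.mem_insert_iff, hd.mem_verts]
    constructor
    · rintro (rfl | ⟨v, hv, rfl⟩)
      · exact ⟨none, rfl, rfl⟩
      · exact ⟨some v, hv, rfl⟩
    · rintro ⟨_ | v, hv, rfl⟩
      · exact Or.inl rfl
      · exact Or.inr ⟨v, hv, rfl⟩
  · intro f
    rw [hd.mem_edges]
    constructor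
    · rintro ⟨w, hw, rfl⟩
      exact ⟨some w, hw, hnbr w⟩
    · rintro ⟨_ | w, hw, rfl⟩
      · exact absurd hw (by simp [BdGraph.newVertex])
      · exact ⟨w, hw, (hnbr w).symm⟩
  · intro j b hj
    by_cases hjz : j = z
    · subst hjz
      rw [Function.update_self] at hj
      cases hj
      exact ⟨rfl, rfl⟩
    · rw [Function.update_of_ne hjz] at hj
      rw [hl j hjz]
      exact hd.lab_inl j b hj
  · intro j f hj
    by_cases hjz : j = z
    · subst hjz
      rw [Function.update_self] at hj
      cases hj
    · rw [Function.update_of_ne hjz] at hj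
      rw [hl j hjz, hnbr]
      exact hd.lab_inr j f hj

/-- A new hyperedge may consist of any labelled vertices, except the one whose label it takes
over. -/
theorem Generated.newEdge [Nonempty A] (ht : 2 ≤ t) (h : Generated S F lab) (i : Fin t)
    {f : Set A} (hf : ∀ a ∈ f, ∃ j, j ≠ i ∧ lab j = Sum.inl a) :
    Generated S (insert f F) (Function.update lab i (Sum.inr f)) := by
  let z : Fin t := ⟨0, by omega⟩
  suffices key : ∀ lab : Fin t → A ⊕ Set A, Generated S F lab →
      (∀ a ∈ f, ∃ j, j ≠ z ∧ lab j = Sum.inl a) →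
      Generated S (insert f F) (Function.update lab z (Sum.inr f)) by
    have h1 := (key _ (h.relabel ht (Equiv.swap z i)) fun a ha => by
      obtain ⟨j, hj, hja⟩ := hf a ha
      exact ⟨Equiv.swap z i j, fun hjz => hj ((Equiv.swap z i).injective
        (hjz.trans (Equiv.swap_apply_right z i).symm)), by simpa using hja⟩).relabel ht
      (Equiv.swap z i)
    rwa [update_comp_swap] at h1
  rintro lab ⟨G, φ, ⟨p, hp⟩, hd⟩ hf
  let J : Set (Fin t) := {j | j ≠ z ∧ ∃ a ∈ f, lab j = Sum.inl a}
  let φ' : (G.newVertex 1).V → A := fun v => Option.elim v (Classical.arbitrary A) φ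
  have hlz : (G.newVertex 1).lab z = none := rfl
  have hl : ∀ j, j ≠ z → (G.newVertex 1).lab j = some (G.lab j) := fun j hj =>
    if_neg fun h => hj (Fin.ext h)
  let G' := (G.newVertex 1).addEdges z J
  have hG' : Parsable G' := Parsable.addEdges ht ⟨_, Parses.newVertex 1 hp⟩ fun h => h.1 rfl
  have hcol : ∀ j ∈ J, G.color (G.lab j) = 0 := by
    rintro j ⟨-, a, -, hj⟩
    exact (hd.lab_inl j a hj).1
  have hsome : ∀ u v, G'.graph.Adj (some u) (some v) ↔ G.graph.Adj u v := by
    intro u v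
    refine (BdGraph.addEdges_adj _ _ _ _ _).trans ((or_congr_left (newVertex_adj G 1 _ _)).trans ?_)
    constructor
    · rintro (⟨a, b, h, ha, hb⟩ | ⟨-, ⟨h, -⟩ | ⟨h, -⟩⟩)
      · cases ha
        cases hb
        exact h
      · exact (Option.some_ne_none _ (h.trans hlz)).elim
      · exact (Option.some_ne_none _ (h.trans hlz)).elim
    · exact fun h => Or.inl ⟨u, v, h, rfl, rfl⟩
  have hnone : ∀ v, G'.graph.Adj none (some v) ↔ ∃ j ∈ J, v = G.lab j := by
    intro v
    refine (BdGraph.addEdges_adj _ _ _ _ _).trans ((or_congr_left (newVertex_adj G 1 _ _)).trans ?_)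
    constructor
    · rintro (⟨a, b, -, ha, -⟩ | ⟨-, ⟨-, j, hj, h⟩ | ⟨h, -⟩⟩)
      · cases ha
      · exact ⟨j, hj, Option.some_injective _ (h.trans (hl j hj.1))⟩
      · exact (Option.some_ne_none _ (h.trans hlz)).elim
    · rintro ⟨j, hj, rfl⟩
      exact Or.inr ⟨(Option.some_ne_none _).symm, Or.inl ⟨rfl, j, hj, (hl j hj.1).symm⟩⟩
  have hcolor : G'.color none = 1 := rfl
  have hnbr : ∀ w, G.color w = 1 → G'.nbr φ' (some w) = G.nbr φ w := by
    intro w hw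
    ext b
    constructor
    · rintro ⟨_ | v, hv, rfl⟩
      · obtain ⟨j, hj, rfl⟩ := (hnone w).1 hv.symm
        exact absurd ((hcol j hj).symm.trans hw) (by decide)
      · exact ⟨v, (hsome w v).1 hv, rfl⟩
    · rintro ⟨v, hv, rfl⟩
      exact ⟨some v, (hsome w v).2 hv, rfl⟩
  have hnbr0 : G'.nbr φ' none = f := by
    ext b
    constructor
    · rintro ⟨_ | v, hv, rfl⟩
      · exact absurd hv (G'.graph.irrefl)
      · obtain ⟨j, ⟨-, a, ha, hj⟩, rfl⟩ := (hnone v).1 hv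
        have : φ' (some (G.lab j)) = a := (hd.lab_inl j a hj).2
        exact this ▸ ha
    · intro hb
      obtain ⟨j, hjz, hj⟩ := hf b hb
      exact ⟨some (G.lab j), (hnone _).2 ⟨j, ⟨hjz, b, hb, hj⟩, rfl⟩, (hd.lab_inl j b hj).2⟩
  refine ⟨G', φ', hG', ⟨?_, ?_, ?_, ?_, ?_, ?_⟩⟩
  · rintro (_ | u) (_ | v) huv
    · exact absurd huv (G'.graph.irrefl)
    · obtain ⟨j, hj, rfl⟩ := (hnone v).1 huv
      intro h
      exact absurd (hcolor.symm.trans (h.trans (hcol j hj))) (by decide)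
    · obtain ⟨j, hj, rfl⟩ := (hnone u).1 huv.symm
      intro h
      exact absurd (hcolor.symm.trans (h.symm.trans (hcol j hj))) (by decide)
    · exact hd.wellColored u v ((hsome u v).1 huv)
  · rintro (_ | u) (_ | v) hu hv huv
    · rfl
    · exact absurd (hcolor.symm.trans hu) (by decide)
    · exact absurd (hcolor.symm.trans hv) (by decide)
    · exact congrArg some (hd.inj u v hu hv huv)
  · intro b
    rw [hd.mem_verts]
    constructor
    · rintro ⟨v, hv, rfl⟩
      exact ⟨some v, hv, rfl⟩
    · rintro ⟨_ | v, hv, rfl⟩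
      · exact absurd (hcolor.symm.trans hv) (by decide)
      · exact ⟨v, hv, rfl⟩
  · intro g
    rw [Set.mem_insert_iff, hd.mem_edges]
    constructor
    · rintro (rfl | ⟨w, hw, rfl⟩)
      · exact ⟨none, rfl, hnbr0⟩
      · exact ⟨some w, hw, hnbr w hw⟩
    · rintro ⟨_ | w, hw, rfl⟩
      · exact Or.inl hnbr0
      · exact Or.inr ⟨w, hw, (hnbr w hw).symm⟩
  · intro j b hj
    by_cases hjz : j = z
    · subst hjz
      rw [Function.update_self] at hj
      cases hj
    · rw [Function.update_of_ne hjz] at hj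
      have h1 : G'.lab j = some (G.lab j) := hl j hjz
      rw [h1]
      exact hd.lab_inl j b hj
  · intro j g hj
    by_cases hjz : j = z
    · subst hjz
      rw [Function.update_self] at hj
      cases hj
      exact ⟨rfl, hnbr0⟩
    · rw [Function.update_of_ne hjz] at hj
      have h1 : G'.lab j = some (G.lab j) := hl j hjz
      have h2 := hd.lab_inr j g hj
      rw [h1, hnbr _ h2.1]
      exact h2

/-- With a spare label, any hyperedges that consist of labelled vertices can be added without
changing the labels. -/
theorem Generated.addEdges [Nonempty A] (ht : 2 ≤ t) (h : Generated S F lab) {s : Fin t}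
    (hs : lab s = Sum.inr ∅) {F' : Set (Set A)}
    (hF' : ∀ f ∈ F', ∀ a ∈ f, ∃ j, lab j = Sum.inl a) : Generated S (F ∪ F') lab := by
  have hne : ∀ j a, lab j = Sum.inl a → j ≠ s := by
    rintro j a hj rfl
    simp [hs] at hj
  have hempty : ∀ {F : Set (Set A)}, Generated S F lab → ∅ ∈ F := by
    rintro F ⟨G, φ, -, hd⟩
    exact (hd.mem_edges ∅).2 ⟨_, hd.lab_inr s ∅ hs⟩
  have hfin : F'.Finite := by
    refine Set.Finite.subset (s := 𝒫 (Sum.inl ⁻¹' Set.range lab)) ?_ fun f hf a ha => hF' f hf a ha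
    exact ((Set.finite_range lab).preimage Sum.inl_injective.injOn).finite_subsets
  induction F', hfin using Set.Finite.induction_on with
  | empty => simpa using h
  | @insert f F' _ _ ih =>
    have h1 := ih fun g hg => hF' g (Set.mem_insert_of_mem _ hg)
    have h2 := h1.newEdge ht s (f := f) fun a ha => by
      obtain ⟨j, hj⟩ := hF' f (Set.mem_insert _ _) a ha
      exact ⟨j, hne j a hj, hj⟩
    have h3 := h2.newEdge ht s (f := ∅) (by simp)
    rw [Function.update_idem, ← hs, Function.update_eq_self,
      Set.insert_eq_of_mem (Set.mem_insert_of_mem _ (hempty h1))] at h3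
    rwa [Set.union_insert]

/-- A constant operator, whose color-1 vertices get distinct names. -/
theorem generated_isolated {n₁ : ℕ} (hn : n₁ < t) (φ : Fin t → A)
    (hφ : ∀ i j, i.val < n₁ → j.val < n₁ → φ i = φ j → i = j) :
    Generated {a | ∃ i : Fin t, i.val < n₁ ∧ φ i = a} {∅}
      (fun i => if i.val < n₁ then Sum.inl (φ i) else Sum.inr ∅) := by
  have hc : ∀ i, (BdGraph.isolated t n₁).color i = 0 ↔ i.val < n₁ := by
    intro i
    simp [BdGraph.isolated]
  have hc1 : ∀ i, (BdGraph.isolated t n₁).color i = 1 ↔ ¬ i.val < n₁ := by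
    intro i
    rw [← hc]
    omega
  have hnbr : ∀ w, (BdGraph.isolated t n₁).nbr φ w = ∅ := by
    intro w
    exact Set.image_eq_empty.2 (Set.eq_empty_of_forall_notMem fun v hv => hv)
  refine ⟨BdGraph.isolated t n₁, φ, ⟨_, Parses.empty n₁ (t - n₁) (by omega)⟩,
    ⟨fun u v h => h.elim, fun u v hu hv => hφ u v ((hc u).1 hu) ((hc v).1 hv), ?_, ?_, ?_, ?_⟩⟩
  · intro a
    simp only [hc]
    rfl
  · intro f
    simp only [hnbr, Set.mem_singleton_iff]
    constructor
    · rintro rfl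
      exact ⟨⟨n₁, hn⟩, (hc1 _).2 (lt_irrefl n₁), rfl⟩
    · rintro ⟨-, -, rfl⟩
      rfl
  · intro i a hi
    by_cases h : i.val < n₁
    · rw [if_pos h] at hi
      cases hi
      exact ⟨(hc i).2 h, rfl⟩
    · rw [if_neg h] at hi
      cases hi
  · intro i a hi
    by_cases h : i.val < n₁
    · rw [if_pos h] at hi
      cases hi
    · rw [if_neg h] at hi
      cases hi
      exact ⟨(hc1 i).2 h, hnbr _⟩

end Generated

/-! ### Generating the gadget -/

section GadgetGeneration

variable {t : ℕ}

/-- The vertices of a gadget whose chain ends in `n + 1`, built up to the chain vertex `p`. -/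
def gadgetGround (n p : ℕ) : Set (Fin 15 ⊕ ℕ) := {x | ∀ i, x = Sum.inr i → i ≤ p ∨ i = n + 1}

/-- The hyperedges of a gadget that do not depend on the positions along the chain. The pairs join
every constant to all other constants and to both ends of the chain. -/
def gadgetBase (n : ℕ) : Set (Set (Fin 15 ⊕ ℕ)) :=
  {f | f = {Sum.inr (n + 1)} ∨ f = {Sum.inr 0} ∨ f = ∅ ∨
    ∃ k z, ((∃ k', z = Sum.inl k') ∨ z = Sum.inr 0 ∨ z = Sum.inr (n + 1)) ∧ f = {Sum.inl k, z}}

/-- The hyperedges of a gadget, built up to the position `p`. -/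
def gadgetFamily (n p : ℕ) : Set (Set (Fin 15 ⊕ ℕ)) :=
  gadgetBase n ∪ {f | ∃ τ q, q < p ∧ f = typedEdge id τ q}

/-- The labels of a gadget: the first 15 labels are at the constants, two labels at the hyperedges
that contain just one end of the chain, and the others at empty hyperedges. -/
def gadgetLabel (n : ℕ) (i : Fin t) : (Fin 15 ⊕ ℕ) ⊕ Set (Fin 15 ⊕ ℕ) :=
  if h : i.val < 15 then Sum.inl (Sum.inl ⟨i, h⟩)
  else if i.val = 17 then Sum.inr {Sum.inr 0}
  else if i.val = 18 then Sum.inr {Sum.inr (n + 1)}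
  else Sum.inr ∅

/-- The labels while the gadget is built: the chain vertex `p` and the last chain vertex are
labelled, too. -/
def stageLabel (n p : ℕ) (i : Fin t) : (Fin 15 ⊕ ℕ) ⊕ Set (Fin 15 ⊕ ℕ) :=
  if i.val = 15 then Sum.inl (Sum.inr p)
  else if i.val = 16 then Sum.inl (Sum.inr (n + 1))
  else gadgetLabel n i

theorem stageLabel_const (ht : 41 ≤ t) (n p : ℕ) (k : Fin 15) :
    stageLabel (t := t) n p ⟨k.val, by omega⟩ = Sum.inl (Sum.inl k) := by
  have h1 : k.val ≠ 15 := by omega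
  have h2 : k.val ≠ 16 := by omega
  simp [stageLabel, gadgetLabel, h1, h2]

/-- The gadget before its typed hyperedges and inner chain vertices are added. -/
theorem generated_base (ht : 41 ≤ t) (n : ℕ) :
    Generated (gadgetGround n 0) (gadgetFamily n 0) (stageLabel (t := t) n 0) := by
  let φ : Fin t → Fin 15 ⊕ ℕ := fun i =>
    if h : i.val < 15 then Sum.inl ⟨i, h⟩ else if i.val = 15 then Sum.inr 0 else Sum.inr (n + 1)
  have h0 := generated_isolated (t := t) (n₁ := 17) (by omega) φ (by
    intro i j hi hj hij
    simp only [φ] at hij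
    split_ifs at hij <;> simp at hij <;> omega)
  have hS : {a | ∃ i : Fin t, i.val < 17 ∧ φ i = a} = gadgetGround n 0 := by
    ext a
    constructor
    · rintro ⟨i, hi, rfl⟩ j hj
      simp only [φ] at hj
      split_ifs at hj <;> simp at hj <;> omega
    · intro ha
      rcases a with k | j
      · exact ⟨⟨k.val, by omega⟩, by simp; omega, by simp [φ]⟩
      · rcases ha j rfl with h | rfl
        · obtain rfl : j = 0 := by omega
          exact ⟨⟨15, by omega⟩, by simp, by simp [φ]⟩
        · exact ⟨⟨16, by omega⟩, by simp, by simp [φ]⟩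
  rw [hS] at h0
  -- the two labelled singletons
  have h1 := h0.newEdge (by omega) ⟨17, by omega⟩ (f := {Sum.inr 0}) (by
    rintro a rfl
    exact ⟨⟨15, by omega⟩, by simp, by simp [φ]⟩)
  have h2 := h1.newEdge (by omega) ⟨18, by omega⟩ (f := {Sum.inr (n + 1)}) (by
    rintro a rfl
    refine ⟨⟨16, by omega⟩, by simp, ?_⟩
    rw [Function.update_of_ne (by simp)]
    simp [φ])
  have hl : Function.update (Function.update
      (fun i : Fin t => if i.val < 17 then (Sum.inl (φ i) : _ ⊕ Set (Fin 15 ⊕ ℕ)) else Sum.inr ∅)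
      ⟨17, by omega⟩ (Sum.inr {Sum.inr 0})) ⟨18, by omega⟩ (Sum.inr {Sum.inr (n + 1)}) =
      stageLabel n 0 := by
    funext i
    simp only [Function.update_apply, Fin.ext_iff, stageLabel, gadgetLabel, φ]
    split_ifs <;> first | rfl | omega
  rw [hl] at h2
  have h3 := h2.addEdges (by omega) (s := ⟨19, by omega⟩) (by simp [stageLabel, gadgetLabel])
    (F' := {f | ∃ k z, ((∃ k', z = Sum.inl k') ∨ z = Sum.inr 0 ∨ z = Sum.inr (n + 1)) ∧
      f = {Sum.inl k, z}}) (by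
    rintro f ⟨k, z, hz, rfl⟩ a ha
    rcases ha with rfl | rfl
    · exact ⟨_, stageLabel_const ht n 0 k⟩
    · rcases hz with ⟨k', rfl⟩ | rfl | rfl
      · exact ⟨_, stageLabel_const ht n 0 k'⟩
      · exact ⟨⟨15, by omega⟩, by simp [stageLabel]⟩
      · exact ⟨⟨16, by omega⟩, by simp [stageLabel]⟩)
  convert h3 using 1
  ext f
  simp only [gadgetFamily, gadgetBase, Set.mem_union, Set.mem_ofPred_eq, Set.mem_insert_iff,
    Set.mem_singleton_iff, not_lt_zero, false_and, exists_false, or_false, or_assoc]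

theorem gadgetFamily_succ (n p : ℕ) :
    gadgetFamily n (p + 1) = gadgetFamily n p ∪ {f | ∃ τ, f = typedEdge id τ p} := by
  ext f
  simp only [gadgetFamily, Set.mem_union, Set.mem_ofPred_eq, or_assoc]
  refine or_congr_right ?_
  constructor
  · rintro ⟨τ, q, hq, rfl⟩
    rcases Nat.lt_succ_iff_lt_or_eq.1 hq with h | rfl
    · exact Or.inl ⟨τ, q, h, rfl⟩
    · exact Or.inr ⟨τ, rfl⟩
  · rintro (⟨τ, q, hq, rfl⟩ | ⟨τ, rfl⟩)
    · exact ⟨τ, q, by omega, rfl⟩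
    · exact ⟨τ, p, by omega, rfl⟩

/-- The hyperedges at one position can be added if their chain vertices are labelled. -/
theorem Generated.addTyped (ht : 41 ≤ t) {n p : ℕ} {S : Set (Fin 15 ⊕ ℕ)}
    {lab : Fin t → (Fin 15 ⊕ ℕ) ⊕ Set (Fin 15 ⊕ ℕ)}
    (h : Generated S (gadgetFamily n p) lab)
    (hk : ∀ k, ∃ i, lab i = Sum.inl (Sum.inl k)) (hp : ∃ i, lab i = Sum.inl (Sum.inr p))
    (hp' : ∃ i, lab i = Sum.inl (Sum.inr (p + 1))) {s : Fin t} (hs : lab s = Sum.inr ∅) :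
    Generated S (gadgetFamily n (p + 1)) lab := by
  rw [gadgetFamily_succ]
  refine h.addEdges (by omega) hs ?_
  rintro f ⟨τ, rfl⟩ (k | i) ha
  · exact hk k
  · rw [inr_mem_typedEdge] at ha
    rcases ha.2 with rfl | rfl
    · exact hp
    · exact hp'

theorem generated_stage (ht : 41 ≤ t) (n p : ℕ) (hp : p ≤ n) :
    Generated (gadgetGround n p) (gadgetFamily n p) (stageLabel (t := t) n p) := by
  induction p with
  | zero => exact generated_base ht n
  | succ p ih =>
    have h1 := (ih (by omega)).newVertex (by omega) ⟨19, by omega⟩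
      (a := Sum.inr (p + 1)) (by
        intro h
        rcases h _ rfl with h | h <;> omega)
    have hS : insert (Sum.inr (p + 1)) (gadgetGround n p) = gadgetGround n (p + 1) := by
      ext a
      rcases a with k | j
      · simp [gadgetGround]
      · simp only [gadgetGround, Set.mem_insert_iff, Sum.inr.injEq, Set.mem_ofPred_eq,
          forall_eq']
        omega
    rw [hS] at h1
    have h2 := h1.addTyped ht (s := ⟨20, by omega⟩)
      (fun k => ⟨⟨k.val, by omega⟩, by
        rw [Function.update_of_ne (by simp; omega), stageLabel_const ht]⟩)
      ⟨⟨15, by omega⟩, by rw [Function.update_of_ne (by simp)]; simp [stageLabel]⟩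
      ⟨⟨19, by omega⟩, by rw [Function.update_self]⟩
      (by rw [Function.update_of_ne (by simp)]; simp [stageLabel, gadgetLabel])
    -- the new chain vertex takes over the label of its predecessor
    have h3 := h2.relabel (by omega) (Equiv.swap ⟨15, by omega⟩ ⟨19, by omega⟩)
    have h4 := h3.newEdge (by omega) ⟨19, by omega⟩ (f := ∅) (by simp)
    have he : (∅ : Set (Fin 15 ⊕ ℕ)) ∈ gadgetFamily n (p + 1) := Or.inl (Or.inr (Or.inr (Or.inl rfl)))
    rw [Set.insert_eq_of_mem he] at h4
    convert h4 using 1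
    funext i
    simp only [Function.update_apply, Function.comp_apply, Equiv.swap_apply_def]
    by_cases h15 : i.val = 15
    · simp [stageLabel, h15, Fin.ext_iff]
    · by_cases h19 : i.val = 19
      · simp [stageLabel, gadgetLabel, h19, Fin.ext_iff]
      · simp [stageLabel, gadgetLabel, h15, h19, Fin.ext_iff]

/-- The gadgets are generated by the parsing operators. -/
theorem generated_gadget (ht : 41 ≤ t) (n : ℕ) :
    Generated (gadgetGround n n) (gadgetFamily n (n + 1)) (gadgetLabel (t := t) n) := by
  have h1 := (generated_stage ht n n le_rfl).addTyped ht (s := ⟨20, by omega⟩)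
    (fun k => ⟨_, stageLabel_const ht n n k⟩) ⟨⟨15, by omega⟩, by simp [stageLabel]⟩
    ⟨⟨16, by omega⟩, by simp [stageLabel]⟩ (by simp [stageLabel, gadgetLabel])
  have h2 := h1.newEdge (by omega) ⟨15, by omega⟩ (f := ∅) (by simp)
  have h3 := h2.newEdge (by omega) ⟨16, by omega⟩ (f := ∅) (by simp)
  have he : (∅ : Set (Fin 15 ⊕ ℕ)) ∈ gadgetFamily n (n + 1) := Or.inl (Or.inr (Or.inr (Or.inl rfl)))
  rw [Set.insert_eq_of_mem he, Set.insert_eq_of_mem he] at h3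
  convert h3 using 1
  funext i
  simp only [Function.update_apply, Fin.ext_iff, stageLabel, gadgetLabel]
  split_ifs <;> first | rfl | omega

end GadgetGeneration

/-! ### Gluing -/

section GluedTypes

variable {L A B : Type} {la : L → A → Prop} {lb : L → B → Prop}

theorem Glued.inl_eq_inr (ha : ∀ i a a', la i a → la i a' → a = a')
    (hb : ∀ i j b, lb i b → lb j b → i = j) {a : A} {b : B} :
    Glued.inl la lb a = Glued.inr la lb b ↔ ∃ i, la i a ∧ lb i b := by
  constructor
  · let f : A ⊕ B → Set A := Sum.elim (fun a => {a}) (fun b => {a | ∃ i, la i a ∧ lb i b})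
    have hf : ∀ x y, GlueRel la lb x y → f x = f y := by
      rintro _ _ ⟨i, a, b, h1, h2⟩
      ext a'
      simp only [f, Sum.elim_inl, Sum.elim_inr, Set.mem_singleton_iff, Set.mem_ofPred_eq]
      constructor
      · rintro rfl
        exact ⟨i, h1, h2⟩
      · rintro ⟨j, h3, h4⟩
        obtain rfl := hb i j b h2 h4
        exact ha _ _ _ h3 h1
    intro h
    have h' : f (Sum.inl a) = f (Sum.inr b) := congrArg (Quot.lift f hf) h
    exact (h'.subset rfl : a ∈ f (Sum.inr b))
  · rintro ⟨i, h1, h2⟩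
    exact Quot.sound ⟨i, a, b, h1, h2⟩

theorem Glued.inr_injective (ha : ∀ i j a, la i a → la j a → i = j)
    (hb : ∀ i b b', lb i b → lb i b' → b = b') : Function.Injective (Glued.inr la lb) := by
  let f : A ⊕ B → Set B := Sum.elim (fun a => {b | ∃ i, la i a ∧ lb i b}) (fun b => {b})
  have hf : ∀ x y, GlueRel la lb x y → f x = f y := by
    rintro _ _ ⟨i, a, b, h1, h2⟩
    ext b'
    simp only [f, Sum.elim_inl, Sum.elim_inr, Set.mem_singleton_iff, Set.mem_ofPred_eq]
    constructor
    · rintro ⟨j, h3, h4⟩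
      obtain rfl := ha i j a h1 h3
      exact hb _ _ _ h4 h2
    · rintro rfl
      exact ⟨i, h1, h2⟩
  intro b b' h
  have h' : f (Sum.inr b) = f (Sum.inr b') := congrArg (Quot.lift f hf) h
  simpa [f] using h'

end GluedTypes

section GraphGluing

variable {t : ℕ}

theorem BdGraph.hyperg_vLab (G : BdGraph t) (i : Fin t) (v : G.hyperg.V) :
    G.hyperg.VLab i v ↔ G.lab i = v.1 := by
  change (if h : G.color (G.lab i) = 0 then Sum.inl ⟨G.lab i, h⟩
    else Sum.inr ⟨G.lab i, by omega⟩ : G.hyperg.V ⊕ G.hyperg.E) = Sum.inl v ↔ _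
  obtain ⟨v, hv⟩ := v
  split_ifs with h
  · exact ⟨fun he => congrArg Subtype.val (Sum.inl_injective he),
      fun he => congrArg Sum.inl (Subtype.ext he)⟩
  · simp only [false_iff]
    rintro rfl
    exact h hv

theorem BdGraph.hyperg_eLab (G : BdGraph t) (i : Fin t) (e : G.hyperg.E) :
    G.hyperg.ELab i e ↔ G.lab i = e.1 := by
  change (if h : G.color (G.lab i) = 0 then Sum.inl ⟨G.lab i, h⟩
    else Sum.inr ⟨G.lab i, by omega⟩ : G.hyperg.V ⊕ G.hyperg.E) = Sum.inr e ↔ _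
  obtain ⟨e, he⟩ := e
  split_ifs with h
  · simp only [false_iff]
    rintro rfl
    exact absurd (h.symm.trans he) (by decide)
  · exact ⟨fun he => congrArg Subtype.val (Sum.inr_injective he),
      fun he => congrArg Sum.inr (Subtype.ext he)⟩

theorem BdGraph.hyperg_gluable_iff (G G' : BdGraph t) :
    BdHypergraph.Gluable G.hyperg G'.hyperg ↔
      ∀ i, G.color (G.lab i) = 0 ↔ G'.color (G'.lab i) = 0 := by
  rw [BdHypergraph.gluable_iff]
  refine forall_congr' fun i => ?_
  have key : ∀ G : BdGraph t, (G.hyperg.lab i).isLeft = decide (G.color (G.lab i) = 0) := by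
    intro G
    change (if h : G.color (G.lab i) = 0 then Sum.inl ⟨G.lab i, h⟩
      else Sum.inr ⟨G.lab i, by omega⟩ : G.hyperg.V ⊕ G.hyperg.E).isLeft = _
    split_ifs with h
    · exact (decide_eq_true h).symm
    · exact (decide_eq_false h).symm
  rw [key, key, decide_eq_decide]

variable {G G' : BdGraph t} (hc : BdGraph.ColorCompatible G G')

theorem BdGraph.glue_adj (hG : G.WellColored) (hG' : G'.WellColored) (x y : (G.glue G' hc).V) :
    (G.glue G' hc).graph.Adj x y ↔
      (∃ u v, G.graph.Adj u v ∧ x = Glued.inl _ _ u ∧ y = Glued.inl _ _ v) ∨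
      (∃ u v, G'.graph.Adj u v ∧ x = Glued.inr _ _ u ∧ y = Glued.inr _ _ v) := by
  constructor
  · rintro ⟨-, (h | h) | (⟨u, v, h, hx, hy⟩ | ⟨u, v, h, hx, hy⟩)⟩
    · exact Or.inl h
    · exact Or.inr h
    · exact Or.inl ⟨v, u, h.symm, hy, hx⟩
    · exact Or.inr ⟨v, u, h.symm, hy, hx⟩
  · intro h
    refine ⟨?_, Or.inl h⟩
    rintro rfl
    rcases h with ⟨u, v, h, hx, hy⟩ | ⟨u, v, h, hx, hy⟩
    · exact hG u v h (congrArg (G.glue G' hc).color (hx.symm.trans hy))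
    · exact hG' u v h (congrArg (G.glue G' hc).color (hx.symm.trans hy))

theorem BdGraph.glue_wellColored (hG : G.WellColored) (hG' : G'.WellColored) :
    (G.glue G' hc).WellColored := by
  intro x y hxy
  rcases (BdGraph.glue_adj hc hG hG' x y).1 hxy with ⟨u, v, h, rfl, rfl⟩ | ⟨u, v, h, rfl, rfl⟩
  · exact hG u v h
  · exact hG' u v h

/-- The map from glued color classes to the color class of the glued graph. -/
def glueColorClass (c : Fin 2) (la : Fin t → {v // G.color v = c} → Prop)
    (lb : Fin t → {v // G'.color v = c} → Prop) (ha : ∀ i a, la i a ↔ G.lab i = a.1)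
    (hb : ∀ i b, lb i b ↔ G'.lab i = b.1) :
    Glued la lb → {x : (G.glue G' hc).V // (G.glue G' hc).color x = c} :=
  Quot.lift (Sum.elim (fun a => ⟨Glued.inl _ _ a.1, a.2⟩) (fun b => ⟨Glued.inr _ _ b.1, b.2⟩)) (by
    rintro _ _ ⟨i, a, b, h1, h2⟩
    exact Subtype.ext (Quot.sound ⟨i, a.1, b.1, (ha i a).1 h1, (hb i b).1 h2⟩))

theorem glueColorClass_bijective (c : Fin 2) (la : Fin t → {v // G.color v = c} → Prop)
    (lb : Fin t → {v // G'.color v = c} → Prop) (ha : ∀ i a, la i a ↔ G.lab i = a.1)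
    (hb : ∀ i b, lb i b ↔ G'.lab i = b.1) :
    Function.Bijective (glueColorClass hc c la lb ha hb) := by
  have hla : ∀ i a a', G.VLab i a → G.VLab i a' → a = a' := fun i a a' h h' => h.symm.trans h'
  have hlb : ∀ i b b', G'.VLab i b → G'.VLab i b' → b = b' := fun i b b' h h' => h.symm.trans h'
  have hla' : ∀ i j a, G.VLab i a → G.VLab j a → i = j :=
    fun i j a h h' => G.lab.injective (h.trans h'.symm)
  have hlb' : ∀ i j b, G'.VLab i b → G'.VLab j b → i = j :=
    fun i j a h h' => G'.lab.injective (h.trans h'.symm)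
  have hlr : ∀ (a : {v // G.color v = c}) (b : {v // G'.color v = c}),
      Glued.inl G.VLab G'.VLab a.1 = Glued.inr G.VLab G'.VLab b.1 →
        Glued.inl la lb a = Glued.inr la lb b := by
    intro a b h
    obtain ⟨i, h1, h2⟩ := (Glued.inl_eq_inr hla hlb').1 h
    exact Quot.sound ⟨i, a, b, (ha i a).2 h1, (hb i b).2 h2⟩
  constructor
  · rintro ⟨a | a⟩ ⟨b | b⟩ hab
    · exact congrArg (Glued.inl la lb)
        (Subtype.ext (Glued.inl_injective hla hlb' (congrArg Subtype.val hab)))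
    · exact hlr a b (congrArg Subtype.val hab)
    · exact (hlr b a (congrArg Subtype.val hab).symm).symm
    · exact congrArg (Glued.inr la lb)
        (Subtype.ext (Glued.inr_injective hla' hlb (congrArg Subtype.val hab)))
  · rintro ⟨⟨a | b⟩, h⟩
    · exact ⟨Glued.inl la lb ⟨a, h⟩, rfl⟩
    · exact ⟨Glued.inr la lb ⟨b, h⟩, rfl⟩

theorem Presents.of_iso {A : Type} {H H' : MultiHypergraph} {S : Set A} {F : Set (Set A)}
    {ψ : H.V → A} (h : Presents H S F ψ) (e : H.V ≃ H'.V) (g : H.E → H'.E)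
    (hg : Function.Surjective g) (hinc : ∀ q, e '' H.inc q = H'.inc (g q)) :
    Presents H' S F (ψ ∘ e.symm) := by
  have himg : ∀ q, (ψ ∘ e.symm) '' H'.inc (g q) = ψ '' H.inc q := by
    intro q
    rw [← hinc, Set.image_comp, ← Set.image_comp e.symm]
    simp
  refine ⟨h.inj.comp e.symm.injective, ?_, fun q' => ?_, fun f hf => ?_⟩
  · rw [Set.range_comp, e.symm.surjective.range_eq, Set.image_univ, h.range]
  · obtain ⟨q, rfl⟩ := hg q'
    rw [himg]
    exact h.le q
  · obtain ⟨q, hq⟩ := h.ge f hf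
    exact ⟨g q, (himg q).symm ▸ hq⟩

/-- Gluing graphs and gluing the hypergraphs that they represent amount to the same. -/
theorem Presents.of_glue_hyperg (hG : G.WellColored) (hG' : G'.WellColored)
    {hg : BdHypergraph.Gluable G.hyperg G'.hyperg} {A : Type} {S : Set A} {F : Set (Set A)}
    {ψ : (G.hyperg.glue G'.hyperg hg).V → A}
    (h : Presents (G.hyperg.glue G'.hyperg hg).toMultiHypergraph S F ψ) :
    ∃ ψ', Presents (G.glue G' hc).hyperg.toMultiHypergraph S F ψ' := by
  have hV := glueColorClass_bijective hc 0 _ _ G.hyperg_vLab G'.hyperg_vLab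
  have hE := glueColorClass_bijective hc 1 _ _ G.hyperg_eLab G'.hyperg_eLab
  refine ⟨_, h.of_iso (H' := (G.glue G' hc).hyperg.toMultiHypergraph)
    (Equiv.ofBijective _ hV) _ hE.2 fun q => ?_⟩
  ext y
  constructor
  · rintro ⟨x, ⟨e, v, rfl, hv, rfl⟩ | ⟨e, v, rfl, hv, rfl⟩, rfl⟩
    · exact (BdGraph.glue_adj hc hG hG' _ _).2 (Or.inl ⟨e.1, v.1, hv, rfl, rfl⟩)
    · exact (BdGraph.glue_adj hc hG hG' _ _).2 (Or.inr ⟨e.1, v.1, hv, rfl, rfl⟩)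
  · obtain ⟨y, hy⟩ := y
    intro hadj
    set w := glueColorClass hc 1 _ _ G.hyperg_eLab G'.hyperg_eLab q with hw
    rcases (BdGraph.glue_adj hc hG hG' w.1 y).1 hadj with ⟨u, v, huv, hu, rfl⟩ | ⟨u, v, huv, hu, rfl⟩
    · have hu1 : G.color u = 1 := (congrArg (G.glue G' hc).color hu).symm.trans w.2
      have hq : q = Glued.inl _ _ ⟨u, hu1⟩ := hE.1 (Subtype.ext hu)
      exact ⟨Glued.inl _ _ ⟨v, hy⟩, Or.inl ⟨⟨u, hu1⟩, ⟨v, hy⟩, hq, huv, rfl⟩, rfl⟩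
    · have hu1 : G'.color u = 1 := (congrArg (G.glue G' hc).color hu).symm.trans w.2
      have hq : q = Glued.inr _ _ ⟨u, hu1⟩ := hE.1 (Subtype.ext hu)
      exact ⟨Glued.inr _ _ ⟨v, hy⟩, Or.inr ⟨⟨u, hu1⟩, ⟨v, hy⟩, hq, huv, rfl⟩, rfl⟩

end GraphGluing

/-! ### The glued gadgets -/

section GluedGadgets

/-- The name in the glued gadgets of a vertex of the gadget `h`. -/
def side (h : Bool) : Fin 15 ⊕ ℕ → Fin 15 ⊕ Bool × ℕ := Sum.map id (Prod.mk h)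

theorem side_injective (h : Bool) : Function.Injective (side h) :=
  Function.Injective.sumMap Function.injective_id fun _ _ hij => (Prod.mk.inj hij).2

theorem side_image_typedEdge (h : Bool) (τ : Fin 4) (p : ℕ) :
    side h '' typedEdge id τ p = typedEdge (fun i => (h, i)) τ p := by
  ext x
  constructor
  · rintro ⟨k | i, hx, rfl⟩
    · exact inl_mem_typedEdge.2 (inl_mem_typedEdge.1 hx)
    · have h1 := inr_mem_typedEdge.1 hx
      exact inr_mem_typedEdge.2 ⟨h1.1, h1.2.imp (congrArg (Prod.mk h)) (congrArg (Prod.mk h))⟩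
  · rcases x with k | b
    · exact fun hx => ⟨Sum.inl k, inl_mem_typedEdge.2 (inl_mem_typedEdge.1 hx), rfl⟩
    · intro hx
      obtain ⟨hτ, rfl | rfl⟩ := inr_mem_typedEdge.1 hx
      · exact ⟨Sum.inr p, inr_mem_typedEdge.2 ⟨hτ, Or.inl rfl⟩, rfl⟩
      · exact ⟨Sum.inr (p + 1), inr_mem_typedEdge.2 ⟨hτ, Or.inr rfl⟩, rfl⟩

theorem exists_gluedFamily_of_gadgetFamily {ℓ : Bool → ℕ} {h : Bool} {f}
    (hf : f ∈ gadgetFamily (ℓ h) (ℓ h + 1)) : ∃ g ∈ gluedFamily ℓ, side h '' f ⊆ g := by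
  rcases hf with (rfl | rfl | rfl | ⟨k, z, hz, rfl⟩) | ⟨τ, q, hq, rfl⟩
  · refine ⟨_, Or.inr (Or.inr (Or.inr rfl)), ?_⟩
    cases h <;> simp [side]
  · refine ⟨_, Or.inr (Or.inr (Or.inl rfl)), ?_⟩
    cases h <;> simp [side]
  · exact ⟨_, Or.inr (Or.inr (Or.inl rfl)), by simp⟩
  · refine ⟨{side h (Sum.inl k), side h z}, Or.inr (Or.inl ⟨h, k, side h z, ?_, rfl⟩), ?_⟩
    · rcases hz with ⟨k', rfl⟩ | rfl | rfl
      · exact Or.inl ⟨k', rfl⟩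
      · exact Or.inr (Or.inl rfl)
      · exact Or.inr (Or.inr rfl)
    · rw [Set.image_pair]
  · exact ⟨_, Or.inl ⟨h, τ, q, by omega, rfl⟩, (side_image_typedEdge h τ q).subset⟩

theorem exists_gadgetFamily_of_gluedFamily {ℓ : Bool → ℕ} {g} (hg : g ∈ gluedFamily ℓ) :
    (∃ h, ∃ f ∈ gadgetFamily (ℓ h) (ℓ h + 1), g ⊆ side h '' f) ∨
    g = {Sum.inr (true, 0), Sum.inr (false, 0)} ∨
    g = {Sum.inr (true, ℓ true + 1), Sum.inr (false, ℓ false + 1)} := by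
  rcases hg with ⟨h, τ, q, hq, rfl⟩ | ⟨h, k, z, hz, rfl⟩ | hg
  · exact Or.inl ⟨h, _, Or.inr ⟨τ, q, by omega, rfl⟩, (side_image_typedEdge h τ q).superset⟩
  · rcases hz with ⟨k', rfl⟩ | rfl | rfl
    · exact Or.inl ⟨h, _, Or.inl (Or.inr (Or.inr (Or.inr ⟨k, Sum.inl k', Or.inl ⟨k', rfl⟩, rfl⟩))),
        by rw [Set.image_pair]; rfl⟩
    · exact Or.inl ⟨h, _, Or.inl (Or.inr (Or.inr (Or.inr ⟨k, Sum.inr 0,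
        Or.inr (Or.inl rfl), rfl⟩))), by rw [Set.image_pair]; rfl⟩
    · exact Or.inl ⟨h, _, Or.inl (Or.inr (Or.inr (Or.inr ⟨k, Sum.inr (ℓ h + 1),
        Or.inr (Or.inr rfl), rfl⟩))), by rw [Set.image_pair]; rfl⟩
  · exact Or.inr hg

variable {t : ℕ}

/-- The names `φ` identify the graph `G` with the gadget whose chain ends in `n + 1`. -/
abbrev IsGadget (G : BdGraph t) (φ : G.V → Fin 15 ⊕ ℕ) (n : ℕ) : Prop :=
  Describes G φ (gadgetGround n n) (gadgetFamily n (n + 1)) (gadgetLabel n)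

variable {G : BdGraph t} {φ : G.V → Fin 15 ⊕ ℕ} {n : ℕ}

theorem IsGadget.color_eq_zero_iff (h : IsGadget G φ n) (i : Fin t) :
    G.color (G.lab i) = 0 ↔ i.val < 15 := by
  constructor
  · intro hc
    by_contra hi
    obtain ⟨f, hf⟩ : ∃ f, gadgetLabel n i = Sum.inr f := by
      unfold gadgetLabel
      rw [dif_neg hi]
      split_ifs <;> exact ⟨_, rfl⟩
    exact absurd (hc.symm.trans (h.lab_inr i f hf).1) (by decide)
  · intro hi
    exact (h.lab_inl i _ (dif_pos hi)).1

theorem IsGadget.label_const (h : IsGadget G φ n) {i : Fin t} (hi : i.val < 15) :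
    φ (G.lab i) = Sum.inl ⟨i, hi⟩ :=
  (h.lab_inl i _ (dif_pos hi)).2

theorem IsGadget.label_of_name (h : IsGadget G φ n) (ht : 41 ≤ t) {v : G.V} {k : Fin 15}
    (hv : G.color v = 0) (hk : φ v = Sum.inl k) : G.lab ⟨k.val, by omega⟩ = v :=
  h.inj _ _ ((h.color_eq_zero_iff _).2 k.2) hv ((h.label_const k.2).trans hk.symm)

/-- In a well-colored graph, the names of the vertices of a hyperedge are those of all neighbors. -/
theorem BdGraph.image_inc (G : BdGraph t) (φ : G.V → Fin 15 ⊕ ℕ) (hG : G.WellColored)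
    (e : G.hyperg.E) : (fun v : G.hyperg.V => φ v.1) '' G.hyperg.inc e = G.nbr φ e.1 := by
  ext a
  constructor
  · rintro ⟨v, hv, rfl⟩
    exact ⟨v.1, hv, rfl⟩
  · rintro ⟨v, hv, rfl⟩
    have hv0 : G.color v = 0 := by
      have h1 := hG e.1 v hv
      have h2 := e.2
      omega
    exact ⟨⟨v, hv0⟩, hv, rfl⟩

variable {G' : BdGraph t} {φ' : G'.V → Fin 15 ⊕ ℕ} {m : ℕ}

theorem IsGadget.gluable (h : IsGadget G φ n) (h' : IsGadget G' φ' m) :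
    BdHypergraph.Gluable G.hyperg G'.hyperg :=
  (BdGraph.hyperg_gluable_iff G G').2 fun i =>
    (h.color_eq_zero_iff i).trans (h'.color_eq_zero_iff i).symm

theorem IsGadget.colorCompatible (h : IsGadget G φ n) (h' : IsGadget G' φ' m) :
    BdGraph.ColorCompatible G G' := fun i => by
  have := (h.color_eq_zero_iff i).trans (h'.color_eq_zero_iff i).symm
  omega

/-- Gluing two gadgets identifies the constants and unites the labelled hyperedges at the ends of
the chains. -/
theorem IsGadget.presents_glue (ht : 41 ≤ t) (h : IsGadget G φ n) (h' : IsGadget G' φ' m)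
    (hg : BdHypergraph.Gluable G.hyperg G'.hyperg) :
    ∃ ψ, Presents (G.hyperg.glue G'.hyperg hg).toMultiHypergraph
      (gluedGround fun b => if b then n else m) (gluedFamily fun b => if b then n else m) ψ := by
  set ℓ : Bool → ℕ := fun b => if b then n else m with hℓ
  let ψ : (G.hyperg.glue G'.hyperg hg).V → Fin 15 ⊕ Bool × ℕ :=
    Quot.lift (Sum.elim (fun v => side true (φ v.1)) (fun v => side false (φ' v.1))) (by
      rintro _ _ ⟨i, a, b, ha, hb⟩
      have ha' := (G.hyperg_vLab i a).1 ha
      have hb' := (G'.hyperg_vLab i b).1 hb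
      have hi : i.val < 15 := (h.color_eq_zero_iff i).1 (ha' ▸ a.2)
      simp only [Sum.elim_inl, Sum.elim_inr]
      rw [← ha', ← hb', h.label_const hi, h'.label_const hi]
      rfl)
  have hel : ∀ i e e', G.hyperg.ELab i e → G.hyperg.ELab i e' → e = e' := fun i e e' h1 h2 =>
    Subtype.ext (((G.hyperg_eLab i e).1 h1).symm.trans ((G.hyperg_eLab i e').1 h2))
  have her : ∀ i e e', G'.hyperg.ELab i e → G'.hyperg.ELab i e' → e = e' := fun i e e' h1 h2 =>
    Subtype.ext (((G'.hyperg_eLab i e).1 h1).symm.trans ((G'.hyperg_eLab i e').1 h2))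
  have hel' : ∀ i j e, G.hyperg.ELab i e → G.hyperg.ELab j e → i = j := fun i j e h1 h2 =>
    G.lab.injective (((G.hyperg_eLab i e).1 h1).trans ((G.hyperg_eLab j e).1 h2).symm)
  have her' : ∀ i j e, G'.hyperg.ELab i e → G'.hyperg.ELab j e → i = j := fun i j e h1 h2 =>
    G'.lab.injective (((G'.hyperg_eLab i e).1 h1).trans ((G'.hyperg_eLab j e).1 h2).symm)
  have hmeet : ∀ v w, side true (φ v.1) = side false (φ' w.1) →
      Glued.inl G.hyperg.VLab G'.hyperg.VLab v = Glued.inr _ _ w := by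
    intro v w hvw
    rcases hv : φ v.1 with k | i <;> rcases hw : φ' w.1 with k' | j <;> rw [hv, hw] at hvw
    · obtain rfl : k = k' := Sum.inl_injective hvw
      exact Quot.sound ⟨⟨k.val, by omega⟩, v, w,
        (G.hyperg_vLab _ v).2 (h.label_of_name ht v.2 hv),
        (G'.hyperg_vLab _ w).2 (h'.label_of_name ht w.2 hw)⟩
    · cases hvw
    · cases hvw
    · exact absurd (congrArg Prod.fst (Sum.inr_injective hvw)) (by simp)
  -- the image of a hyperedge consists of the images of its parts
  have hpart : ∀ q, ψ '' (G.hyperg.glue G'.hyperg hg).inc q =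
      {a | (∃ e, q = Glued.inl _ _ e ∧ a ∈ side true '' G.nbr φ e.1) ∨
        ∃ e, q = Glued.inr _ _ e ∧ a ∈ side false '' G'.nbr φ' e.1} := by
    intro q
    ext a
    constructor
    · rintro ⟨x, ⟨e, v, hq, hv, rfl⟩ | ⟨e, v, hq, hv, rfl⟩, rfl⟩
      · exact Or.inl ⟨e, hq, φ v.1, ⟨v.1, hv, rfl⟩, rfl⟩
      · exact Or.inr ⟨e, hq, φ' v.1, ⟨v.1, hv, rfl⟩, rfl⟩
    · rintro (⟨e, hq, b, hb, rfl⟩ | ⟨e, hq, b, hb, rfl⟩)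
      · rw [← BdGraph.image_inc G φ h.wellColored] at hb
        obtain ⟨v, hv, rfl⟩ := hb
        exact ⟨Glued.inl _ _ v, Or.inl ⟨e, v, hq, hv, rfl⟩, rfl⟩
      · rw [← BdGraph.image_inc G' φ' h'.wellColored] at hb
        obtain ⟨v, hv, rfl⟩ := hb
        exact ⟨Glued.inr _ _ v, Or.inr ⟨e, v, hq, hv, rfl⟩, rfl⟩
  refine ⟨ψ, ⟨?_, ?_, ?_, ?_⟩⟩
  · rintro ⟨v | v⟩ ⟨w | w⟩ hvw
    · exact congrArg (Glued.inl _ _)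
        (Subtype.ext (h.inj _ _ v.2 w.2 (side_injective true hvw)))
    · exact hmeet v w hvw
    · exact (hmeet w v hvw.symm).symm
    · exact congrArg (Glued.inr _ _)
        (Subtype.ext (h'.inj _ _ v.2 w.2 (side_injective false hvw)))
  · ext a
    constructor
    · rintro ⟨⟨v | v⟩, rfl⟩ b i hbi
      · have hv := (h.mem_verts (φ v.1)).2 ⟨v.1, v.2, rfl⟩
        change side true (φ v.1) = _ at hbi
        rcases hφ : φ v.1 with k | j <;> rw [hφ] at hbi
        · cases hbi
        · cases hbi
          have := hv i hφ
          simp only [hℓ, if_true]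
          omega
      · have hv := (h'.mem_verts (φ' v.1)).2 ⟨v.1, v.2, rfl⟩
        change side false (φ' v.1) = _ at hbi
        rcases hφ : φ' v.1 with k | j <;> rw [hφ] at hbi
        · cases hbi
        · cases hbi
          have := hv i hφ
          simp only [hℓ]
          simp
          omega
    · intro ha
      rcases a with k | ⟨b, i⟩
      · obtain ⟨v, hv, hφ⟩ := (h.mem_verts (Sum.inl k)).1 fun i hi => by cases hi
        exact ⟨Glued.inl _ _ ⟨v, hv⟩, congrArg (side true) hφ⟩
      · have hi := ha b i rfl
        cases b
        · obtain ⟨v, hv, hφ⟩ := (h'.mem_verts (Sum.inr i)).1 fun j hj => by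
            cases hj
            simp only [hℓ] at hi
            simp at hi
            omega
          exact ⟨Glued.inr _ _ ⟨v, hv⟩, congrArg (side false) hφ⟩
        · obtain ⟨v, hv, hφ⟩ := (h.mem_verts (Sum.inr i)).1 fun j hj => by
            cases hj
            simp only [hℓ, if_true] at hi
            omega
          exact ⟨Glued.inl _ _ ⟨v, hv⟩, congrArg (side true) hφ⟩
  · intro q
    rw [hpart]
    have hF : ∀ e : G.hyperg.E, ∃ g ∈ gluedFamily ℓ, side true '' G.nbr φ e.1 ⊆ g := fun e =>
      exists_gluedFamily_of_gadgetFamily (h := true) ((h.mem_edges _).2 ⟨e.1, e.2, rfl⟩)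
    have hF' : ∀ e : G'.hyperg.E, ∃ g ∈ gluedFamily ℓ, side false '' G'.nbr φ' e.1 ⊆ g :=
      fun e => exists_gluedFamily_of_gadgetFamily (h := false)
        ((h'.mem_edges _).2 ⟨e.1, e.2, rfl⟩)
    by_cases hq : ∃ e e', q = Glued.inl _ _ e ∧ q = Glued.inr _ _ e'
    · -- two labelled hyperedges have been united
      obtain ⟨e, e', hqe, hqe'⟩ := hq
      obtain ⟨i, hi, hi'⟩ := (Glued.inl_eq_inr hel her').1 (hqe.symm.trans hqe')
      have h1 := (G.hyperg_eLab i e).1 hi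
      have h2 := (G'.hyperg_eLab i e').1 hi'
      have hi15 : ¬ i.val < 15 := by
        rw [← h.color_eq_zero_iff, h1]
        intro h3
        exact absurd (h3.symm.trans e.2) (by decide)
      have hsub : ∀ f f' g, gadgetLabel n i = Sum.inr f → gadgetLabel m i = Sum.inr f' →
          side true '' f ⊆ g → side false '' f' ⊆ g →
          {a | (∃ e, q = Glued.inl _ _ e ∧ a ∈ side true '' G.nbr φ e.1) ∨
            ∃ e, q = Glued.inr _ _ e ∧ a ∈ side false '' G'.nbr φ' e.1} ⊆ g := by
        intro f f' g hf hf' hfg hfg'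
        rintro a (⟨e₁, hq₁, ha⟩ | ⟨e₁, hq₁, ha⟩)
        · obtain rfl : e = e₁ := Glued.inl_injective hel her' (hqe.symm.trans hq₁)
          rw [← h1, (h.lab_inr i f hf).2] at ha
          exact hfg ha
        · obtain rfl : e' = e₁ := Glued.inr_injective hel' her (hqe'.symm.trans hq₁)
          rw [← h2, (h'.lab_inr i f' hf').2] at ha
          exact hfg' ha
      by_cases h17 : i.val = 17
      · exact ⟨_, Or.inr (Or.inr (Or.inl rfl)), hsub {Sum.inr 0} {Sum.inr 0} _
          (by simp [gadgetLabel, h17]) (by simp [gadgetLabel, h17]) (by simp [side])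
          (by simp [side])⟩
      by_cases h18 : i.val = 18
      · exact ⟨_, Or.inr (Or.inr (Or.inr rfl)), hsub {Sum.inr (n + 1)} {Sum.inr (m + 1)} _
          (by simp [gadgetLabel, h18]) (by simp [gadgetLabel, h18]) (by simp [side, hℓ])
          (by simp [side, hℓ])⟩
      · exact ⟨_, Or.inr (Or.inr (Or.inl rfl)), hsub ∅ ∅ _
          (by simp [gadgetLabel, hi15, h17, h18]) (by simp [gadgetLabel, hi15, h17, h18])
          (by simp) (by simp)⟩
    · rcases hq' : q with ⟨e | e⟩
      · obtain ⟨g, hgF, heg⟩ := hF e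
        refine ⟨g, hgF, ?_⟩
        rintro a (⟨e₁, hq₁, ha⟩ | ⟨e₁, hq₁, ha⟩)
        · obtain rfl : e = e₁ := Glued.inl_injective hel her' hq₁
          exact heg ha
        · exact absurd ⟨e, e₁, hq', hq'.trans hq₁⟩ hq
      · obtain ⟨g, hgF, heg⟩ := hF' e
        refine ⟨g, hgF, ?_⟩
        rintro a (⟨e₁, hq₁, ha⟩ | ⟨e₁, hq₁, ha⟩)
        · exact absurd ⟨e₁, e, hq'.trans hq₁, hq'⟩ hq
        · obtain rfl : e = e₁ := Glued.inr_injective hel' her hq₁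
          exact heg ha
  · intro g hgF
    have hunion : ∀ (i : Fin t) f f', gadgetLabel n i = Sum.inr f → gadgetLabel m i = Sum.inr f' →
        ∃ q, side true '' f ∪ side false '' f' ⊆
          ψ '' (G.hyperg.glue G'.hyperg hg).inc q := by
      intro i f f' hf hf'
      have h1 := h.lab_inr i f hf
      have h2 := h'.lab_inr i f' hf'
      let e : G.hyperg.E := ⟨G.lab i, h1.1⟩
      let e' : G'.hyperg.E := ⟨G'.lab i, h2.1⟩
      refine ⟨Glued.inl _ _ e, ?_⟩
      refine subset_trans ?_ (hpart (Glued.inl _ _ e)).superset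
      rintro a (ha | ha)
      · exact Or.inl ⟨e, rfl, h1.2.symm ▸ ha⟩
      · exact Or.inr ⟨e', Quot.sound ⟨i, e, e', (G.hyperg_eLab i e).2 rfl,
          (G'.hyperg_eLab i e').2 rfl⟩, h2.2.symm ▸ ha⟩
    rcases exists_gadgetFamily_of_gluedFamily hgF with ⟨b, f, hf, hgf⟩ | rfl | rfl
    · cases b
      · obtain ⟨w, hw, rfl⟩ := (h'.mem_edges f).1 hf
        refine ⟨Glued.inr _ _ ⟨w, hw⟩, subset_trans ?_ (hpart (Glued.inr _ _ ⟨w, hw⟩)).superset⟩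
        exact fun a ha => Or.inr ⟨⟨w, hw⟩, rfl, hgf ha⟩
      · obtain ⟨w, hw, rfl⟩ := (h.mem_edges f).1 hf
        refine ⟨Glued.inl _ _ ⟨w, hw⟩, subset_trans ?_ (hpart (Glued.inl _ _ ⟨w, hw⟩)).superset⟩
        exact fun a ha => Or.inl ⟨⟨w, hw⟩, rfl, hgf ha⟩
    · obtain ⟨q, hq⟩ := hunion ⟨17, by omega⟩ {Sum.inr 0} {Sum.inr 0} (by simp [gadgetLabel])
        (by simp [gadgetLabel])
      exact ⟨q, subset_trans (by simp [side, Set.insert_subset_iff]) hq⟩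
    · obtain ⟨q, hq⟩ := hunion ⟨18, by omega⟩ {Sum.inr (n + 1)} {Sum.inr (m + 1)}
        (by simp [gadgetLabel]) (by simp [gadgetLabel])
      exact ⟨q, subset_trans (by simp [side, Set.insert_subset_iff, hℓ]) hq⟩

end GluedGadgets

end HTW

open HTW in
theorem theorem6 (t : ℕ) (ht : 41 ≤ t) :
    -- the canonical right congruence has infinitely many classes over the small universe
    Infinite (Quotient
      (HTW.BdHypergraph.canonicalCongruence (HTW.smallUniverse t) (HTW.GHTW t 4))) ∧
    -- witnesses
    (∃ (H : ℕ → HTW.BdHypergraph t)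
        (g : ∀ n m, HTW.BdHypergraph.Gluable (H n) (H m)),
      (∀ n, H n ∈ HTW.smallUniverse t) ∧
      ∀ n m, ((H n).glue (H m) (g n m)).toMultiHypergraph.ghtw = 4 ↔ n = m) ∧
    -- no finite tree automaton decides membership from parse trees
    (¬ ∃ M : HTW.TreeAutomaton (HTW.Op t),
      ∀ (p : HTW.BinTree (HTW.Op t)) (G : HTW.BdGraph t),
        HTW.Parses p G → G.WellColored → (M.Accepts p ↔ G.hyperg ∈ HTW.GHTW t 4)) := by
  choose G φ hG hd using generated_gadget (t := t) ht
  choose p hp using hG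
  have hg : ∀ n m, BdHypergraph.Gluable (G n).hyperg (G m).hyperg :=
    fun n m => IsGadget.gluable (hd n) (hd m)
  have hH : ∀ n, (G n).hyperg ∈ smallUniverse t :=
    fun n => ⟨p n, G n, hp n, (hd n).wellColored, rfl⟩
  have hpres := fun n m => IsGadget.presents_glue ht (hd n) (hd m) (hg n m)
  have hle : ∀ n m, (G n).hyperg.glue (G m).hyperg (hg n m) ∈ GHTW t 4 ↔ n = m := by
    intro n m
    obtain ⟨ψ, hψ⟩ := hpres n m
    refine ⟨fun h => by simpa using hψ.length_eq h, ?_⟩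
    rintro rfl
    simp only [ite_self] at hψ
    exact hψ.ghtw_le_four
  refine ⟨?_, ⟨fun n => (G n).hyperg, hg, hH, fun n m => ?_⟩, ?_⟩
  · refine Infinite.of_injective (fun n : ℕ => Quotient.mk _ ⟨(G n).hyperg, hH n⟩) fun n m h => ?_
    have h1 := (Quotient.exact h).2 (G m).hyperg (hH m) (hg n m) (hg m m)
    exact (hle n m).1 (h1.2 ((hle m m).2 rfl))
  · obtain ⟨ψ, hψ⟩ := hpres n m
    rw [← hle n m]
    exact ⟨fun h => h.le, fun h => le_antisymm h hψ.four_le_ghtw⟩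
  · rintro ⟨M, hM⟩
    have := M.finQ
    obtain ⟨n, m, hnm, hrun⟩ := Finite.exists_ne_map_eq_of_infinite fun n => M.run (p n)
    have hacc : ∀ k, M.Accepts (.node₂ .glue (p k) (p m)) ↔ k = m := by
      intro k
      have hc := IsGadget.colorCompatible (hd k) (hd m)
      rw [hM _ _ (Parses.glue hc (hp k) (hp m))
        (BdGraph.glue_wellColored hc (hd k).wellColored (hd m).wellColored)]
      obtain ⟨ψ, hψ⟩ := hpres k m
      obtain ⟨ψ', hψ'⟩ := hψ.of_glue_hyperg hc (hd k).wellColored (hd m).wellColored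
      refine ⟨fun h => by simpa using hψ'.length_eq h, ?_⟩
      rintro rfl
      simp only [ite_self] at hψ'
      exact hψ'.ghtw_le_four
    refine hnm ((hacc n).1 ?_)
    have h1 := (hacc m).2 rfl
    simp only [TreeAutomaton.Accepts, TreeAutomaton.run] at h1 ⊢
    rwa [hrun]
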